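/- **Setting.** Let $\varphi:(0,+\infty)\to(0,+\infty)$ satisfy: (i) $\varphi\in C^1((0,+\infty))$; (ii) $(s\varphi(s))'>0$ for all $s>0$; (iii) the range of $s\mapsto s\varphi(s)$ is $(0,+\infty)$; (iv) there are $C_1,C_2>0$, $r>-1$ and $s_0>0$ with $C_1s^r\le (s\varphi(s))'\le C_2s^r$ for $s\in(0,s_0)$; if $r=0$, moreover the finite limit $\lim_{s\to0^+}\varphi(s)>0$ exists and $\lim_{s\to0^+}s\varphi'(s)=0$; (v) there is $s_1>s_0$ such that either $\varphi'\ge0$ on $[s_1,+\infty)$ or $\varphi'\le 0$ on $[s_1,+\infty)$; (vi) $s\mapsto|s\varphi'(s)/\varphi(s)|$ is non-decreasing on $(0,+\infty)$. Define $\Lambda:(0,+\infty)\to\mathbb R$ by $$\Lambda\big(s\sqrt{\varphi(s)}\big)=-\frac{s\varphi'(s)}{s\varphi'(s)+2\varphi(s)}\qquad(s>0),$$ and $\Lambda_\infty^2=\sup_{t>0}\Lambda^2(t)$. Let $(a,b)\subset\mathbb R$ be a bounded or unbounded open interval, let $\mathscr A(x)=\{a_{ij}(x)\}$ be an $m\times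 m$ matrix with complex entries in $L^1_{\rm loc}((a,b))$, and let $Au=(\mathscr A(x)u')'$. Write $\langle\cdot,\cdot\rangle$ for the Hermitian product on $\mathbb C^m$, and $\mathring C^1$ for the space of $\mathbb C^m$-valued $C^1$ functions with compact support in $(a,b)$. Expressions $\varphi(|u|)u$ and $\sqrt{\varphi(|u|)}\,u$ are $0$ where $u=0$. * $A$ is *$L^\Phi$-dissipative* if $\Re\int_a^b\langle\mathscr A u',(\varphi(|u|)u)'\rangle\,dx\ge0$ for all $u\in\mathring C^1$ with $\varphi(|u|)u\in\mathring C^1$. * $A$ is *strict $L^\Phi$-dissipative* if there is $\kappa>0$ such that $\Re\int_a^b\langle\mathscr A u',(\varphi(|u|)u)'\rangle\,dx\ge\kappa\int_a^b|(\sqrt{\varphi(|u|)}\,u)'|^2dx$ for all such $u$. * $\mathscr A$ is *strongly $\Phi$-elliptic* if there is $\kappa>0$ such that for almost every $x\in(a,b)$, all $t>0$ and all $\xi,\omega\in\mathbb C^m$ with $|\omega|=1$, $$\Re\langle\mathscr A(x)\xi,\xi\rangle+\Lambda(t)\,\Re\langle(\mathscr A(x)-\mathscr A^*(x))\omega,\xi\rangle\,\Re\langle\omega,\xi\rangle-\Lambda^2(t)\,\Re\langle\mathscr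 A(x)\omega,\omega\rangle(\Re\langle\omega,\xi\rangle)^2\ge\kappa|\xi|^2 .$$ * $\mathscr A$ is *integrally $\Phi$-elliptic* if there is $\kappa>0$ such that for all $v\in\mathring C^1$ $$\Re\int_a^b\Big(\langle\mathscr A v',v'\rangle+\Lambda(|v|)|v|^{-2}\langle(\mathscr A-\mathscr A^*)v,v'\rangle\Re\langle v,v'\rangle-\Lambda^2(|v|)|v|^{-4}\langle\mathscr A v,v\rangle(\Re\langle v,v'\rangle)^2\Big)dx\ge\kappa\int_a^b|v'|^2dx,$$ where the integrand on the left is taken to be $0$ where $v=0$. * $\mathscr A$ is *weakly $\Phi$-elliptic* if there is $\kappa>0$ such that for almost every $x\in(a,b)$, all $t>0$, $q\in\mathbb R$ and $\lambda,\omega\in\mathbb C^m$ with $|\omega|=1$, $$\Re\langle q^2\mathscr A(x)\lambda,\lambda\rangle-\Lambda^2(t)\Re\langle q^2\mathscr A(x)\omega,\omega\rangle(\Re\langle\lambda,\omega\rangle)^2+\Lambda(t)\Re\big(\langle q^2\mathscr A(x)\omega,\lambda\rangle-\langle q^2\mathscr A(x)\lambda,\omega\rangle\big)\Re\langle\lambda,\omega\rangle\ge\kappa|q|^2|\lambda|^2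 .$$ **Theorem.** Assume $\Lambda_\infty^2<1$. Then the following are equivalent: (a) $A$ is strict $L^\Phi$-dissipative; (b) there is $\kappa>0$ such that $A-\kappa I\,d^2/dx^2$ is $L^\Phi$-dissipative, i.e. the operator $u\mapsto((\mathscr A-\kappa I)u')'$ is; (c) $\mathscr A$ is strongly $\Phi$-elliptic; (d) $\mathscr A$ is integrally $\Phi$-elliptic; (e) $\mathscr A$ is weakly $\Phi$-elliptic. -/

import Mathlib

open Set Filter Topology MeasureTheory

namespace FunctionalDissipativity

noncomputable section

/-- The standing conditions on the weight `φ`; only its values on `(0, ∞)` matter. -/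
structure Admissible (φ : ℝ → ℝ) : Prop where
  pos : ∀ s, 0 < s → 0 < φ s
  contDiffOn : ContDiffOn ℝ 1 φ (Ioi 0)
  deriv_pos : ∀ s, 0 < s → 0 < deriv (fun σ => σ * φ σ) s
  range_eq : (fun s => s * φ s) '' Ioi 0 = Ioi 0
  /-- Behaviour near `0` (for `s < s₀`) and near infinity (for `s ≥ s₁ > s₀`). -/
  growth : ∃ C₁ C₂ r s₀ : ℝ, 0 < C₁ ∧ 0 < C₂ ∧ -1 < r ∧ 0 < s₀ ∧
    (∀ s ∈ Ioo 0 s₀, C₁ * s ^ r ≤ deriv (fun σ => σ * φ σ) s ∧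
      deriv (fun σ => σ * φ σ) s ≤ C₂ * s ^ r) ∧
    (r = 0 → (∃ l : ℝ, 0 < l ∧ Tendsto φ (𝓝[>] 0) (𝓝 l)) ∧
      Tendsto (fun s => s * deriv φ s) (𝓝[>] 0) (𝓝 0)) ∧
    ∃ s₁, s₀ < s₁ ∧ ((∀ s, s₁ ≤ s → 0 ≤ deriv φ s) ∨ (∀ s, s₁ ≤ s → deriv φ s ≤ 0))
  monotone_abs : MonotoneOn (fun s => |s * deriv φ s / φ s|) (Ioi 0)

/-- `Λ(t) = - s φ'(s) / (s φ'(s) + 2 φ(s))`, where `s > 0` is determined by `s √(φ(s)) = t`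
(see `existsUnique_param` and `Lam_apply` below). -/
def Lam (φ : ℝ → ℝ) (t : ℝ) : ℝ :=
  let s := Function.invFunOn (fun σ => σ * √(φ σ)) (Ioi 0) t;
  (-(s * deriv φ s)) / (s * deriv φ s + 2 * φ s)

/-- `Λ_∞² = sup_{t > 0} Λ(t)²` (the set is bounded by `1`, see `Lam_sq_lt_one`). -/
def LamInftySq (φ : ℝ → ℝ) : ℝ := sSup ((fun t => Lam φ t ^ 2) '' Ioi 0)

/-- The open interval `(a, b)`, bounded or unbounded. -/
def interval (a b : EReal) : Set ℝ := {x : ℝ | a < (x : EReal) ∧ (x : EReal) < b}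

/-- `Re ⟨z, w⟩` for the standard Hermitian product of `ℂ^m`, linear in the first slot. -/
def reInner {m : ℕ} (z w : EuclideanSpace ℂ (Fin m)) : ℝ := (inner ℂ w z).re

/-- The vector `M z`. -/
def act {m : ℕ} (M : Matrix (Fin m) (Fin m) ℂ) (z : EuclideanSpace ℂ (Fin m)) :
    EuclideanSpace ℂ (Fin m) := WithLp.toLp 2 (M.mulVec z.ofLp)

/-- Compactly supported `C¹` functions on `Ω` with values in `ℂ^m`, extended by zero to `ℝ`. -/
def TestFun {m : ℕ} (Ω : Set ℝ) (u : ℝ → EuclideanSpace ℂ (Fin m)) : Prop :=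
  ContDiff ℝ 1 u ∧ HasCompactSupport u ∧ tsupport u ⊆ Ω

/-- The function `φ(|u|) u`. -/
def weighted {m : ℕ} (φ : ℝ → ℝ) (u : ℝ → EuclideanSpace ℂ (Fin m)) :
    ℝ → EuclideanSpace ℂ (Fin m) := fun x => φ ‖u x‖ • u x

/-- `L^Φ`-dissipativity of `u ↦ (A u')'` on `Ω`. -/
def Dissipative {m : ℕ} (φ : ℝ → ℝ) (Ω : Set ℝ) (A : ℝ → Matrix (Fin m) (Fin m) ℂ) : Prop :=
  ∀ u : ℝ → EuclideanSpace ℂ (Fin m), TestFun Ω u → TestFun Ω (weighted φ u) →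
    0 ≤ ∫ x in Ω, reInner (act (A x) (deriv u x)) (deriv (weighted φ u) x)

/-- Strict `L^Φ`-dissipativity of `u ↦ (A u')'` on `Ω`. -/
def StrictDissipative {m : ℕ} (φ : ℝ → ℝ) (Ω : Set ℝ)
    (A : ℝ → Matrix (Fin m) (Fin m) ℂ) : Prop :=
  ∃ κ : ℝ, 0 < κ ∧
    ∀ u : ℝ → EuclideanSpace ℂ (Fin m), TestFun Ω u → TestFun Ω (weighted φ u) →
      κ * ∫ x in Ω, ‖deriv (weighted (fun s => √(φ s)) u) x‖ ^ 2 ≤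
        ∫ x in Ω, reInner (act (A x) (deriv u x)) (deriv (weighted φ u) x)

/-- Strong `Φ`-ellipticity (one space dimension). -/
def StrongElliptic {m : ℕ} (φ : ℝ → ℝ) (Ω : Set ℝ)
    (A : ℝ → Matrix (Fin m) (Fin m) ℂ) : Prop :=
  ∃ κ : ℝ, 0 < κ ∧ ∀ᵐ x ∂(volume.restrict Ω), ∀ t : ℝ, 0 < t →
    ∀ ξ ω : EuclideanSpace ℂ (Fin m), ‖ω‖ = 1 →
      κ * ‖ξ‖ ^ 2 ≤ reInner (act (A x) ξ) ξ
        + Lam φ t * reInner (act (A x - (A x).conjTranspose) ω) ξ * reInner ω ξ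
        - Lam φ t ^ 2 * reInner (act (A x) ω) ω * reInner ω ξ ^ 2

open Classical in
/-- The integrand of the form in the integral `Φ`-ellipticity condition, extended by zero to the
set where `v` vanishes. -/
def ellipticIntegrand {m : ℕ} (φ : ℝ → ℝ) (A : ℝ → Matrix (Fin m) (Fin m) ℂ)
    (v : ℝ → EuclideanSpace ℂ (Fin m)) (x : ℝ) : ℝ :=
  if v x = 0 then 0 else
    reInner (act (A x) (deriv v x)) (deriv v x)
      + Lam φ ‖v x‖ * (‖v x‖ ^ 2)⁻¹ *
          reInner (act (A x - (A x).conjTranspose) (v x)) (deriv v x) * reInner (v x) (deriv v x)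
      - Lam φ ‖v x‖ ^ 2 * (‖v x‖ ^ 4)⁻¹ * reInner (act (A x) (v x)) (v x) *
          reInner (v x) (deriv v x) ^ 2

/-- Integral `Φ`-ellipticity (one space dimension). -/
def IntegralElliptic {m : ℕ} (φ : ℝ → ℝ) (Ω : Set ℝ)
    (A : ℝ → Matrix (Fin m) (Fin m) ℂ) : Prop :=
  ∃ κ : ℝ, 0 < κ ∧ ∀ v : ℝ → EuclideanSpace ℂ (Fin m), TestFun Ω v →
    κ * ∫ x in Ω, ‖deriv v x‖ ^ 2 ≤ ∫ x in Ω, ellipticIntegrand φ A v x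

/-- Weak (Legendre-Hadamard) `Φ`-ellipticity (one space dimension). -/
def WeakElliptic {m : ℕ} (φ : ℝ → ℝ) (Ω : Set ℝ)
    (A : ℝ → Matrix (Fin m) (Fin m) ℂ) : Prop :=
  ∃ κ : ℝ, 0 < κ ∧ ∀ᵐ x ∂(volume.restrict Ω), ∀ t : ℝ, 0 < t →
    ∀ (q : ℝ) (ξ ω : EuclideanSpace ℂ (Fin m)), ‖ω‖ = 1 →
      κ * |q| ^ 2 * ‖ξ‖ ^ 2 ≤ reInner (act ((q * q) • A x) ξ) ξ
        - Lam φ t ^ 2 * reInner (act ((q * q) • A x) ω) ω * reInner ξ ω ^ 2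
        + Lam φ t * (reInner (act ((q * q) • A x) ω) ξ - reInner (act ((q * q) • A x) ξ) ω) *
            reInner ξ ω

/-! Facts that make `Lam` and `LamInftySq` meaningful. -/

theorem strictMonoOn_mul {φ : ℝ → ℝ} (h : Admissible φ) :
    StrictMonoOn (fun s => s * φ s) (Ioi 0) := by
  refine strictMonoOn_of_deriv_pos (convex_Ioi 0)
    (continuousOn_id.mul h.contDiffOn.continuousOn) fun s hs => ?_
  rw [interior_Ioi] at hs
  exact h.deriv_pos s hs

theorem mul_sqrt_eq (φ : ℝ → ℝ) {s : ℝ} (hs : 0 < s) :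
    s * √(φ s) = √(s * (s * φ s)) := by
  rw [← mul_assoc, Real.sqrt_mul (by positivity), Real.sqrt_mul_self hs.le]

theorem strictMonoOn_mul_sqrt {φ : ℝ → ℝ} (h : Admissible φ) :
    StrictMonoOn (fun s => s * √(φ s)) (Ioi 0) := by
  intro s hs t ht hst
  have hs' : 0 < s := hs
  have ht' : 0 < t := ht
  have := strictMonoOn_mul h hs ht hst
  have h1 := mul_pos hs' (h.pos s hs')
  simp only at this
  simp only [mul_sqrt_eq φ hs', mul_sqrt_eq φ ht']
  exact Real.sqrt_lt_sqrt (by positivity) (mul_lt_mul'' hst this hs'.le h1.le)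

theorem existsUnique_param {φ : ℝ → ℝ} (h : Admissible φ) {t : ℝ} (ht : 0 < t) :
    ∃! s, 0 < s ∧ s * √(φ s) = t := by
  have hex : ∃ s ∈ Ioi (0 : ℝ), s * (s * φ s) = t ^ 2 := by
    obtain ⟨p, hp, hpt⟩ : t ∈ (fun s => s * φ s) '' Ioi 0 := by rw [h.range_eq]; exact ht
    have hp' : 0 < p := hp
    simp only at hpt
    have hsub : uIcc p t ⊆ Ioi 0 := fun y hy => lt_of_lt_of_le (lt_min hp' ht) hy.1
    have hc : ContinuousOn (fun s => s * (s * φ s)) (uIcc p t) :=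
      (continuousOn_id.mul (continuousOn_id.mul h.contDiffOn.continuousOn)).mono hsub
    have hmem : t ^ 2 ∈ uIcc (p * (p * φ p)) (t * (t * φ t)) := by
      have hm := (strictMonoOn_mul h).monotoneOn
      rcases le_total p t with hle | hle
      · have := hm hp ht hle
        simp only at this
        apply mem_uIcc_of_le <;> nlinarith
      · have := hm ht hp hle
        simp only at this
        apply mem_uIcc_of_ge <;> nlinarith
    obtain ⟨s, hs, hst⟩ := intermediate_value_uIcc hc hmem
    exact ⟨s, hsub hs, hst⟩
  obtain ⟨s, hs, hst⟩ := hex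
  refine ⟨s, ⟨hs, ?_⟩, fun y hy => ?_⟩
  · rw [mul_sqrt_eq φ hs, hst, Real.sqrt_sq ht.le]
  · refine (strictMonoOn_mul_sqrt h).injOn hy.1 hs ?_
    rw [hy.2, mul_sqrt_eq φ hs, hst, Real.sqrt_sq ht.le]

theorem Lam_apply {φ : ℝ → ℝ} (h : Admissible φ) {s : ℝ} (hs : 0 < s) :
    Lam φ (s * √(φ s)) = -(s * deriv φ s) / (s * deriv φ s + 2 * φ s) := by
  have : Function.invFunOn (fun σ => σ * √(φ σ)) (Ioi 0) (s * √(φ s)) = s :=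
    (strictMonoOn_mul_sqrt h).injOn.leftInvOn_invFunOn hs
  simp only [Lam, this]

theorem Lam_sq_lt_one {φ : ℝ → ℝ} (h : Admissible φ) {t : ℝ} (ht : 0 < t) :
    Lam φ t ^ 2 < 1 := by
  obtain ⟨s, ⟨hs, rfl⟩, -⟩ := existsUnique_param h ht
  have hφ := h.pos s hs
  have hd : DifferentiableAt ℝ φ s :=
    (h.contDiffOn.differentiableOn one_ne_zero).differentiableAt (Ioi_mem_nhds hs)
  have h1 := h.deriv_pos s hs
  have h2 : deriv (fun σ => σ * φ σ) s = 1 * φ s + s * deriv φ s :=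
    ((hasDerivAt_id' s).mul hd.hasDerivAt).deriv
  rw [h2] at h1
  have hpos : 0 < s * deriv φ s + 2 * φ s := by linarith
  rw [Lam_apply h hs, div_pow, div_lt_one (by positivity)]
  nlinarith

end

end FunctionalDissipativity

/-!
The real-linear operators `a + b Π_y`, with `Π_y` the orthogonal projection onto `ℝ y`, commute, and
the differential of a radial map `y ↦ f(|y|) y` is one of them. For `v = √φ(|u|) u` this algebra
turns the integrand `Re ⟨𝒜 u', (φ(|u|) u)'⟩` into the form
`Re ⟨𝒜 (1 + Λ Π_v) v', (1 - Λ Π_v) v'⟩` with `Λ = Λ(|v|)`, which is the integrand of integral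
ellipticity; for `𝒜 = I` it lies between `(1 - Λ_∞²) |v'|²` and `|v'|²`. Hence pointwise
ellipticity integrates to the integral conditions, and subtracting `κ I` from `𝒜` trades coercivity
for nonnegativity.

Conversely, to localize a nonnegative integral, perturb a function that is constant, equal to
`y ≠ 0`, on a neighbourhood of a compact set by a small oscillation of high frequency in the
direction `ξ`. The function stays near `y` while its derivative becomes large, so the rescaled
integral tends to that of the form at `(y, ξ)` weighted by the square of a bump function. The
passage from `0` to the plateau must keep both `u` and `φ(|u|) u` of class `C¹`; a profile built
from the resolvent `(1 + F)⁻¹` of `F(s) = s φ(s)` achieves this whatever the behaviour of `φ`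
near `0`.
-/

namespace FunctionalDissipativity

open scoped InnerProductSpace

noncomputable section

section IncreasingDiffeo

/-- A `C¹` diffeomorphism of `(0, ∞)` onto itself with positive derivative. Conditions (i)–(iii) on
the weight `φ` say that `s ↦ s φ(s)` is one. The values outside `(0, ∞)` are unconstrained. -/
structure IncreasingDiffeo (f : ℝ → ℝ) : Prop where
  contDiffOn : ContDiffOn ℝ 1 f (Ioi 0)
  deriv_pos : ∀ s, 0 < s → 0 < deriv f s
  image_eq : f '' Ioi 0 = Ioi 0

theorem strictMonoOn_Ioi_of_deriv_pos {f : ℝ → ℝ} (hf : ContDiffOn ℝ 1 f (Ioi 0))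
    (hf' : ∀ s, 0 < s → 0 < deriv f s) : StrictMonoOn f (Ioi 0) :=
  strictMonoOn_of_deriv_pos (convex_Ioi 0) hf.continuousOn
    fun s hs => hf' s (interior_subset hs)

namespace IncreasingDiffeo

theorem of_tendsto {f : ℝ → ℝ} (hf : ContDiffOn ℝ 1 f (Ioi 0))
    (hf' : ∀ s, 0 < s → 0 < deriv f s) (h_zero : Tendsto f (𝓝[>] 0) (𝓝 0))
    (h_top : Tendsto f atTop atTop) : IncreasingDiffeo f := by
  refine ⟨hf, hf', Subset.antisymm ?_ ?_⟩
  · rintro - ⟨s, hs : 0 < s, rfl⟩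
    have hmono := strictMonoOn_Ioi_of_deriv_pos hf hf'
    have hhalf : 0 < s / 2 := half_pos hs
    have hnonneg : 0 ≤ f (s / 2) := by
      refine le_of_tendsto h_zero ?_
      filter_upwards [Ioo_mem_nhdsGT hhalf] with r hr using (hmono hr.1 hhalf hr.2).le
    exact hnonneg.trans_lt (hmono hhalf hs (half_lt_self hs))
  · exact isPreconnected_Ioi.intermediate_value_Ioi (l₁ := 𝓝[>] 0) inf_le_right
      (le_principal_iff.2 (Ioi_mem_atTop 0)) hf.continuousOn h_zero h_top

theorem id : IncreasingDiffeo fun s => s :=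
  ⟨contDiffOn_id, fun s _ => by simp, image_id _⟩

theorem congr {f g : ℝ → ℝ} (hf : IncreasingDiffeo f) (h : EqOn g f (Ioi 0)) :
    IncreasingDiffeo g :=
  ⟨hf.contDiffOn.congr h,
    fun s hs => (h.deriv isOpen_Ioi hs).symm ▸ hf.deriv_pos s hs, h.image_eq ▸ hf.image_eq⟩

variable {f g : ℝ → ℝ}

section
variable (hf : IncreasingDiffeo f)
include hf

theorem strictMonoOn : StrictMonoOn f (Ioi 0) :=
  strictMonoOn_Ioi_of_deriv_pos hf.contDiffOn hf.deriv_pos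

theorem mapsTo : MapsTo f (Ioi 0) (Ioi 0) := mapsTo_iff_image_subset.2 hf.image_eq.subset

theorem pos {s : ℝ} (hs : 0 < s) : 0 < f s := hf.mapsTo hs

theorem hasDerivAt {s : ℝ} (hs : 0 < s) : HasDerivAt f (deriv f s) s :=
  ((hf.contDiffOn.differentiableOn one_ne_zero).differentiableAt (Ioi_mem_nhds hs)).hasDerivAt

theorem exists_pos_eq {t : ℝ} (ht : 0 < t) : ∃ s ∈ Ioi 0, f s = t := hf.image_eq.superset ht

theorem tendsto_zero : Tendsto f (𝓝[>] 0) (𝓝 0) := by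
  refine (nhdsGT_basis (0 : ℝ)).tendsto_iff (nhds_basis_zero_abs_lt ℝ) |>.2 fun ε hε => ?_
  obtain ⟨s, hs, rfl⟩ := hf.exists_pos_eq hε
  refine ⟨s, hs, fun r hr => ?_⟩
  simpa only [mem_ofPred_eq, abs_of_pos (hf.pos hr.1)] using hf.strictMonoOn hr.1 hs hr.2

theorem tendsto_atTop : Tendsto f atTop atTop := by
  refine atTop_basis_Ioi' 0 |>.tendsto_iff (atTop_basis_Ioi' 0) |>.2 fun t ht => ?_
  obtain ⟨s, hs, rfl⟩ := hf.exists_pos_eq ht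
  exact ⟨s, hs, fun r hr => hf.strictMonoOn hs (mem_Ioi.2 <| lt_trans hs hr) hr⟩

end

theorem add (hf : IncreasingDiffeo f) (hg : IncreasingDiffeo g) :
    IncreasingDiffeo fun s => f s + g s := by
  refine of_tendsto (hf.contDiffOn.add hg.contDiffOn) (fun s hs => ?_)
    (by simpa using hf.tendsto_zero.add hg.tendsto_zero)
    (hf.tendsto_atTop.atTop_add_atTop hg.tendsto_atTop)
  rw [((hf.hasDerivAt hs).fun_add (hg.hasDerivAt hs)).deriv]
  exact add_pos (hf.deriv_pos s hs) (hg.deriv_pos s hs)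

theorem mul (hf : IncreasingDiffeo f) (hg : IncreasingDiffeo g) :
    IncreasingDiffeo fun s => f s * g s := by
  refine of_tendsto (hf.contDiffOn.mul hg.contDiffOn) (fun s hs => ?_)
    (by simpa using hf.tendsto_zero.mul hg.tendsto_zero)
    (hf.tendsto_atTop.atTop_mul_atTop₀ hg.tendsto_atTop)
  rw [((hf.hasDerivAt hs).fun_mul (hg.hasDerivAt hs)).deriv]
  exact add_pos (mul_pos (hf.deriv_pos s hs) (hg.pos hs)) (mul_pos (hf.pos hs) (hg.deriv_pos s hs))

theorem sqrt (hf : IncreasingDiffeo f) : IncreasingDiffeo fun s => √(f s) := by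
  refine of_tendsto (hf.contDiffOn.sqrt fun s hs => (hf.pos hs).ne') (fun s hs => ?_)
    (by simpa using hf.tendsto_zero.sqrt) (Real.tendsto_sqrt_atTop.comp hf.tendsto_atTop)
  rw [((hf.hasDerivAt hs).sqrt (hf.pos hs).ne').deriv]
  exact div_pos (hf.deriv_pos s hs) (by have := Real.sqrt_pos.2 (hf.pos hs); positivity)

/-- The inverse function of `f` on `(0, ∞)`. -/
abbrev inverse (f : ℝ → ℝ) : ℝ → ℝ := Function.invFunOn f (Ioi 0)

section
variable (hf : IncreasingDiffeo f)
include hf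

theorem inverse_pos {t : ℝ} (ht : 0 < t) : 0 < inverse f t :=
  Function.invFunOn_mem (hf.exists_pos_eq ht)

theorem apply_inverse {t : ℝ} (ht : 0 < t) : f (inverse f t) = t :=
  Function.invFunOn_eq (hf.exists_pos_eq ht)

theorem inverse_apply {s : ℝ} (hs : 0 < s) : inverse f (f s) = s :=
  hf.strictMonoOn.injOn.leftInvOn_invFunOn hs

theorem continuousAt_inverse {t : ℝ} (ht : 0 < t) : ContinuousAt (inverse f) t := by
  have hmono : StrictMonoOn (inverse f) (Ioi 0) := fun a ha b hb hab =>
    (hf.strictMonoOn.lt_iff_lt (hf.inverse_pos ha) (hf.inverse_pos hb)).1 <| by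
      rwa [hf.apply_inverse ha, hf.apply_inverse hb]
  have himage : inverse f '' Ioi 0 = Ioi 0 := Subset.antisymm
    (image_subset_iff.2 fun t ht => hf.inverse_pos ht)
    fun s hs => ⟨f s, hf.pos hs, hf.inverse_apply hs⟩
  exact hmono.continuousAt_of_image_mem_nhds (Ioi_mem_nhds ht)
    (himage.symm ▸ Ioi_mem_nhds (hf.inverse_pos ht))

theorem hasDerivAt_inverse {t : ℝ} (ht : 0 < t) :
    HasDerivAt (inverse f) (deriv f (inverse f t))⁻¹ t :=
  .of_local_left_inverse (hf.continuousAt_inverse ht) (hf.hasDerivAt (hf.inverse_pos ht))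
    (hf.deriv_pos _ (hf.inverse_pos ht)).ne'
    ((eventually_gt_nhds ht).mono fun _ => hf.apply_inverse)

theorem continuousOn_deriv : ContinuousOn (deriv f) (Ioi 0) :=
  hf.contDiffOn.continuousOn_deriv_of_isOpen isOpen_Ioi le_rfl

end

end IncreasingDiffeo

end IncreasingDiffeo

section Weight

variable {φ : ℝ → ℝ}

theorem Admissible.increasingDiffeo (hφ : Admissible φ) : IncreasingDiffeo fun s => s * φ s :=
  ⟨contDiffOn_id.mul hφ.contDiffOn, hφ.deriv_pos, hφ.range_eq⟩

namespace IncreasingDiffeo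

variable (hφ : IncreasingDiffeo fun s => s * φ s)
include hφ

theorem weight_pos {s : ℝ} (hs : 0 < s) : 0 < φ s := pos_of_mul_pos_right (hφ.pos hs) hs.le

theorem contDiffOn_weight : ContDiffOn ℝ 1 φ (Ioi 0) :=
  (hφ.contDiffOn.div contDiffOn_id fun _ hs => (mem_Ioi.1 hs).ne').congr
    fun _ hs => (mul_div_cancel_left₀ _ (mem_Ioi.1 hs).ne').symm

theorem hasDerivAt_weight {s : ℝ} (hs : 0 < s) : HasDerivAt φ (deriv φ s) s :=
  ((hφ.contDiffOn_weight.differentiableOn one_ne_zero).differentiableAt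
    (Ioi_mem_nhds hs)).hasDerivAt

theorem continuousOn_deriv_weight : ContinuousOn (deriv φ) (Ioi 0) :=
  hφ.contDiffOn_weight.continuousOn_deriv_of_isOpen isOpen_Ioi le_rfl

theorem hasDerivAt_sqrt_weight {s : ℝ} (hs : 0 < s) :
    HasDerivAt (fun r => √(φ r)) (deriv φ s / (2 * √(φ s))) s :=
  (hφ.hasDerivAt_weight hs).sqrt (hφ.weight_pos hs).ne'

theorem weight_add_mul_deriv_pos {s : ℝ} (hs : 0 < s) : 0 < φ s + s * deriv φ s := by
  have h := ((hasDerivAt_id' s).fun_mul (hφ.hasDerivAt_weight hs)).deriv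
  simpa only [h, one_mul] using hφ.deriv_pos s hs

theorem mul_deriv_add_two_mul_weight_pos {s : ℝ} (hs : 0 < s) : 0 < s * deriv φ s + 2 * φ s := by
  linarith [hφ.weight_add_mul_deriv_pos hs, hφ.weight_pos hs]

theorem mul_sqrt_weight : IncreasingDiffeo fun s => s * √(φ s) :=
  (IncreasingDiffeo.id.mul hφ).sqrt.congr fun _ hs => mul_sqrt_eq φ hs

theorem Lam_mul_sqrt {s : ℝ} (hs : 0 < s) :
    Lam φ (s * √(φ s)) = -(s * deriv φ s) / (s * deriv φ s + 2 * φ s) := by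
  have : Function.invFunOn (fun r => r * √(φ r)) (Ioi 0) (s * √(φ s)) = s :=
    hφ.mul_sqrt_weight.inverse_apply hs
  simp only [Lam, this]

theorem Lam_sq_lt_one {t : ℝ} (ht : 0 < t) : Lam φ t ^ 2 < 1 := by
  obtain ⟨s, hs : 0 < s, rfl⟩ := hφ.mul_sqrt_weight.exists_pos_eq ht
  have hpos := hφ.mul_deriv_add_two_mul_weight_pos hs
  rw [hφ.Lam_mul_sqrt hs, div_pow, div_lt_one (by positivity)]
  nlinarith [hφ.weight_pos hs, hφ.weight_add_mul_deriv_pos hs]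

theorem Lam_sq_le_LamInftySq {t : ℝ} (ht : 0 < t) : Lam φ t ^ 2 ≤ LamInftySq φ :=
  le_csSup ⟨1, by rintro - ⟨r, hr, rfl⟩; exact (hφ.Lam_sq_lt_one hr).le⟩ ⟨t, ht, rfl⟩

theorem continuousOn_Lam : ContinuousOn (Lam φ) (Ioi 0) := by
  have hinv : ContinuousOn (inverse fun s => s * √(φ s)) (Ioi 0) := fun t ht =>
    (hφ.mul_sqrt_weight.continuousAt_inverse ht).continuousWithinAt
  have hmaps : MapsTo (inverse fun s => s * √(φ s)) (Ioi 0) (Ioi 0) := fun _ =>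
    hφ.mul_sqrt_weight.inverse_pos
  have hnum := hinv.mul (hφ.continuousOn_deriv_weight.comp hinv hmaps)
  have hweight := hφ.contDiffOn_weight.continuousOn.comp hinv hmaps
  exact hnum.neg.div (hnum.add (continuousOn_const.mul hweight))
    fun t ht => (hφ.mul_deriv_add_two_mul_weight_pos (hmaps ht)).ne'

end IncreasingDiffeo

end Weight

section Profile

theorem hasDerivAt_comp_const_mul_sq {G G' : ℝ → ℝ} (hG : ∀ t, 0 < t → HasDerivAt G (G' t) t)
    {c : ℝ} (hc : 0 < c) {τ : ℝ} (hτ : τ ≠ 0) :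
    HasDerivAt (fun τ => G (c * τ ^ 2)) (G' (c * τ ^ 2) * (c * (2 * τ))) τ :=
  (hG (c * τ ^ 2) (by positivity)).comp τ (by simpa using (hasDerivAt_pow 2 τ).const_mul c)

theorem contDiff_comp_const_mul_sq {G G' : ℝ → ℝ} (hG : ∀ t, 0 < t → HasDerivAt G (G' t) t)
    (hG' : ContinuousOn G' (Ioi 0)) (hG'_le : ∀ t, 0 < t → |G' t| ≤ 1)
    (hG_le : ∀ t, 0 ≤ t → |G t| ≤ t) {c : ℝ} (hc : 0 < c) :
    ContDiff ℝ 1 fun τ => G (c * τ ^ 2) := by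
  set g' : ℝ → ℝ := fun τ => G' (c * τ ^ 2) * (c * (2 * τ)) with hg'_def
  have hg'_zero : g' 0 = 0 := by simp [hg'_def]
  have hg'_le (τ : ℝ) : ‖g' τ‖ ≤ |c * (2 * τ)| := by
    rcases eq_or_ne τ 0 with rfl | hτ
    · simp [hg'_def]
    · rw [Real.norm_eq_abs, abs_mul]
      exact mul_le_of_le_one_left (abs_nonneg _) (hG'_le _ (by positivity))
  have hg'_cont : Continuous g' := by
    refine continuous_iff_continuousAt.2 fun τ => ?_
    rcases eq_or_ne τ 0 with rfl | hτ
    · rw [ContinuousAt, hg'_zero]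
      refine squeeze_zero_norm hg'_le (Continuous.tendsto' (by fun_prop) 0 0 (by simp))
    · exact ((hG'.continuousAt (Ioi_mem_nhds (by positivity))).comp
        (f := fun τ => c * τ ^ 2) (by fun_prop)).mul (by fun_prop)
  have hderiv : ∀ τ, HasDerivAt (fun τ => G (c * τ ^ 2)) (g' τ) τ := by
    refine hasDerivAt_of_hasDerivAt_of_ne' (x := 0)
      (fun τ hτ => hasDerivAt_comp_const_mul_sq hG hc hτ) ?_ hg'_cont.continuousAt
    have hzero : G (c * 0 ^ 2) = 0 := by simpa using hG_le 0 le_rfl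
    rw [ContinuousAt, hzero]
    exact squeeze_zero_norm (fun τ => hG_le (c * τ ^ 2) (by positivity))
      (Continuous.tendsto' (by fun_prop) 0 0 (by simp))
  refine contDiff_one_iff_deriv.2 ⟨fun τ => (hderiv τ).differentiableAt, ?_⟩
  rwa [funext fun τ => (hderiv τ).deriv]

namespace IncreasingDiffeo

/-- The resolvent `(1 + F)⁻¹` of `F` on `(0, ∞)`, extended by zero. Unlike `F⁻¹` it has bounded
derivative, and `F ∘ (1 + F)⁻¹ = 1 - (1 + F)⁻¹` is as regular as the resolvent itself, whatever
the behaviour of `F` near `0`. -/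
def resolvent (F : ℝ → ℝ) : ℝ → ℝ := (Ioi 0).indicator (inverse fun s => s + F s)

variable {F : ℝ → ℝ}

theorem resolvent_zero : resolvent F 0 = 0 := indicator_of_notMem self_notMem_Ioi _

theorem resolvent_of_pos {t : ℝ} (ht : 0 < t) : resolvent F t = inverse (fun s => s + F s) t :=
  indicator_of_mem (mem_Ioi.2 ht) _

section
variable (hF : IncreasingDiffeo F)
include hF

theorem id_add : IncreasingDiffeo fun s => s + F s := IncreasingDiffeo.id.add hF

theorem resolvent_nonneg (t : ℝ) : 0 ≤ resolvent F t :=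
  indicator_nonneg (fun _ ht => (hF.id_add.inverse_pos ht).le) t

theorem resolvent_apply {s : ℝ} (hs : 0 < s) : resolvent F (s + F s) = s :=
  (resolvent_of_pos (hF.id_add.pos hs)).trans (hF.id_add.inverse_apply hs)

theorem apply_resolvent (hF_zero : F 0 = 0) {t : ℝ} (ht : 0 ≤ t) :
    F (resolvent F t) = t - resolvent F t := by
  rcases ht.eq_or_lt with rfl | ht
  · rw [resolvent_zero, hF_zero, sub_zero]
  · rw [resolvent_of_pos ht]
    exact eq_sub_of_add_eq' (hF.id_add.apply_inverse ht)

theorem resolvent_le {t : ℝ} (ht : 0 ≤ t) : resolvent F t ≤ t := by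
  rcases ht.eq_or_lt with rfl | ht
  · exact resolvent_zero.le
  · rw [resolvent_of_pos ht]
    linarith [hF.id_add.apply_inverse ht, hF.pos (hF.id_add.inverse_pos ht)]

theorem contDiff_resolvent_mul_sq {c : ℝ} (hc : 0 < c) :
    ContDiff ℝ 1 fun τ => resolvent F (c * τ ^ 2) := by
  have hH := hF.id_add
  have hderiv_ge (t : ℝ) (ht : 0 < t) : 1 ≤ deriv (fun s => s + F s) t := by
    rw [((hasDerivAt_id' t).fun_add (hF.hasDerivAt ht)).deriv]
    exact le_add_of_nonneg_right (hF.deriv_pos t ht).le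
  refine contDiff_comp_const_mul_sq
    (G' := fun t => (deriv (fun s => s + F s) (inverse (fun s => s + F s) t))⁻¹)
    (fun t ht => ?_) ?_ (fun t ht => ?_) (fun t ht => ?_) hc
  · exact (hH.hasDerivAt_inverse ht).congr_of_eventuallyEq
      ((eventually_gt_nhds ht).mono fun _ => resolvent_of_pos)
  · exact (hH.continuousOn_deriv.comp
      (fun t ht => (hH.continuousAt_inverse ht).continuousWithinAt) fun _ => hH.inverse_pos).inv₀
      fun t ht => (hH.deriv_pos _ (hH.inverse_pos ht)).ne'
  · have := hderiv_ge _ (hH.inverse_pos ht)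
    rw [abs_of_pos (by positivity)]
    exact inv_le_one_of_one_le₀ this
  · rw [abs_of_nonneg (hF.resolvent_nonneg t)]
    exact hF.resolvent_le ht

theorem exists_contDiff_profile (hF_zero : F 0 = 0) {s : ℝ} (hs : 0 < s) :
    ∃ γ : ℝ → ℝ, ContDiff ℝ 1 γ ∧ ContDiff ℝ 1 (F ∘ γ) ∧ γ 0 = 0 ∧ γ 1 = s ∧ ∀ τ, 0 ≤ γ τ := by
  have hc : 0 < s + F s := hF.id_add.pos hs
  have hγ := hF.contDiff_resolvent_mul_sq hc
  refine ⟨fun τ => resolvent F ((s + F s) * τ ^ 2), hγ, ?_, by simpa using resolvent_zero,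
    by simpa using hF.resolvent_apply hs, fun τ => hF.resolvent_nonneg _⟩
  have hFγ : (F ∘ fun τ => resolvent F ((s + F s) * τ ^ 2)) =
      fun τ => (s + F s) * τ ^ 2 - resolvent F ((s + F s) * τ ^ 2) :=
    funext fun τ => hF.apply_resolvent hF_zero (by positivity)
  rw [hFγ]
  exact (contDiff_const.mul (contDiff_fun_id.pow 2)).sub hγ

end

end IncreasingDiffeo

end Profile

section RadialMap

variable {E : Type*} [NormedAddCommGroup E] [InnerProductSpace ℝ E]

/-- The operator `a + b Π`, where `Π` is the orthogonal projection onto the real line through `y`.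
For fixed `y` these operators form a commutative algebra, and differentials of radial maps
`y ↦ f(|y|) y` are of this type. -/
def radialMap (a b : ℝ) (y : E) : E →L[ℝ] E := a • 1 + b • (ℝ ∙ y).starProjection

theorem starProjection_span_singleton (y : E) :
    (ℝ ∙ y).starProjection = (‖y‖ ^ 2)⁻¹ • (innerSL ℝ y).smulRight y := by
  ext ξ
  simp [Submodule.starProjection_singleton ℝ, smul_smul, div_eq_inv_mul]

theorem radialMap_apply (a b : ℝ) (y ξ : E) :
    radialMap a b y ξ = a • ξ + (b * (‖y‖ ^ 2)⁻¹ * ⟪y, ξ⟫_ℝ) • y := by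
  simp [radialMap, starProjection_span_singleton, smul_smul, mul_assoc]

theorem radialMap_zero (a : ℝ) (y : E) : radialMap a 0 y = a • 1 := by
  rw [radialMap, zero_smul, add_zero]

theorem smul_radialMap (c a b : ℝ) (y : E) :
    c • radialMap a b y = radialMap (c * a) (c * b) y := by
  simp only [radialMap, smul_add, smul_smul]

theorem radialMap_smul (a b : ℝ) {c : ℝ} (hc : c ≠ 0) (y : E) :
    radialMap a b (c • y) = radialMap a b y := by
  simp only [radialMap, Submodule.span_singleton_smul_eq (IsUnit.mk0 c hc)]

theorem radialMap_mul (a b c d : ℝ) (y : E) :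
    radialMap a b y * radialMap c d y = radialMap (a * c) (a * d + b * c + b * d) y := by
  have hproj : (ℝ ∙ y).starProjection * (ℝ ∙ y).starProjection = (ℝ ∙ y).starProjection :=
    Submodule.isIdempotentElem_starProjection _
  simp only [radialMap, add_mul, mul_add, smul_mul_smul_comm, one_mul, mul_one, hproj]
  module

theorem norm_radialMap_le (a b : ℝ) (y : E) : ‖radialMap a b y‖ ≤ |a| + |b| := by
  refine (norm_add_le _ _).trans (add_le_add ?_ ?_) <;> rw [norm_smul, Real.norm_eq_abs]
  · exact mul_le_of_le_one_right (abs_nonneg a) ContinuousLinearMap.norm_id_le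
  · exact mul_le_of_le_one_right (abs_nonneg b) (Submodule.starProjection_norm_le _)

theorem norm_radialMap_one_apply_le {b : ℝ} {y : E} (hb : y ≠ 0 → |b| ≤ 1) (ξ : E) :
    ‖radialMap 1 b y ξ‖ ≤ 2 * ‖ξ‖ := by
  by_cases hy : y = 0
  · rw [radialMap_apply, hy, smul_zero, one_smul, add_zero]
    linarith [norm_nonneg ξ]
  · refine (radialMap 1 b y).le_of_opNorm_le ((norm_radialMap_le 1 b y).trans ?_) ξ
    rw [abs_one]
    linarith [hb hy]

theorem continuousOn_radialMap {α β : ℝ → ℝ} (hα : ContinuousOn α (Ioi 0))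
    (hβ : ContinuousOn β (Ioi 0)) :
    ContinuousOn (fun y : E => radialMap (α ‖y‖) (β ‖y‖) y) {0}ᶜ := by
  have hmaps : MapsTo (fun y : E => ‖y‖) {0}ᶜ (Ioi 0) := fun _ hy => norm_pos_iff.2 hy
  have hproj : ContinuousOn (fun y : E => (ℝ ∙ y).starProjection) {0}ᶜ := by
    simp only [starProjection_span_singleton]
    exact ((continuous_norm.pow 2).continuousOn.inv₀
      fun y hy => pow_ne_zero 2 (norm_ne_zero_iff.2 hy)).smul
      (isBoundedBilinearMap_smulRight.continuous.comp
        ((innerSL ℝ).continuous.prodMk continuous_id)).continuousOn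
  exact ((hα.comp continuous_norm.continuousOn hmaps).smul continuousOn_const).add
    ((hβ.comp continuous_norm.continuousOn hmaps).smul hproj)

/-- The Fréchet differential at `y ≠ 0` of the radial map `y ↦ f(|y|) y`. -/
def radialJacobian (f : ℝ → ℝ) (y : E) : E →L[ℝ] E :=
  radialMap (f ‖y‖) (‖y‖ * deriv f ‖y‖) y

theorem continuousOn_radialJacobian {f : ℝ → ℝ} (hf : ContDiffOn ℝ 1 f (Ioi 0)) :
    ContinuousOn (radialJacobian f : E → E →L[ℝ] E) {0}ᶜ :=
  continuousOn_radialMap (β := fun s => s * deriv f s) hf.continuousOn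
    (continuousOn_id.mul (hf.continuousOn_deriv_of_isOpen isOpen_Ioi le_rfl))

theorem hasDerivAt_norm_smul {f : ℝ → ℝ} {u : ℝ → E} {u' : E} {x : ℝ} (hu : HasDerivAt u u' x)
    (hx : u x ≠ 0) (hf : DifferentiableAt ℝ f ‖u x‖) :
    HasDerivAt (fun y => f ‖u y‖ • u y) (radialJacobian f (u x) u') x := by
  have hx' : ‖u x‖ ≠ 0 := norm_ne_zero_iff.2 hx
  have hnorm : HasDerivAt (fun y => ‖u y‖) (‖u x‖⁻¹ * ⟪u x, u'⟫_ℝ) x := by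
    have h := hu.norm_sq.sqrt (pow_ne_zero 2 hx')
    simp only [Real.sqrt_sq (norm_nonneg _)] at h
    exact h.congr_deriv (by field_simp)
  refine ((hf.hasDerivAt.comp x hnorm).smul hu).congr_deriv ?_
  rw [radialJacobian, radialMap_apply]
  congr 2
  field_simp

end RadialMap

section EllipticForm

variable {E : Type*} [NormedAddCommGroup E] [InnerProductSpace ℝ E] {φ : ℝ → ℝ}

/-- The quadratic form of the strong and integral `Φ`-ellipticity conditions at `v = y`, `v' = ξ`,
in the factored form `⟨T (1 + Λ Π) ξ, (1 - Λ Π) ξ⟩` with `Λ = Λ(|y|)` and `Π` the orthogonal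
projection onto `ℝ y`; real inner products play the role of `Re ⟨·, ·⟩`. -/
def ellipticForm (φ : ℝ → ℝ) (T : E →L[ℝ] E) (y ξ : E) : ℝ :=
  ⟪T (radialMap 1 (Lam φ ‖y‖) y ξ), radialMap 1 (-Lam φ ‖y‖) y ξ⟫_ℝ

theorem ellipticForm_zero_right (T : E →L[ℝ] E) (y : E) : ellipticForm φ T y 0 = 0 := by
  simp only [ellipticForm, map_zero, inner_zero_left]

theorem ellipticForm_sub_smul_one (T : E →L[ℝ] E) (κ : ℝ) (y ξ : E) :
    ellipticForm φ (T - κ • 1) y ξ = ellipticForm φ T y ξ - κ * ellipticForm φ 1 y ξ := by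
  simp [ellipticForm, inner_sub_left, inner_smul_left]

theorem ellipticForm_one (y ξ : E) :
    ellipticForm φ 1 y ξ = ‖ξ‖ ^ 2 - Lam φ ‖y‖ ^ 2 * ‖(ℝ ∙ y).starProjection ξ‖ ^ 2 := by
  simp only [ellipticForm, radialMap, one_smul, neg_smul, add_apply,
    neg_apply, smul_apply, one_apply_eq_self]
  simp only [inner_add_left, inner_add_right, inner_neg_right, real_inner_smul_left,
    real_inner_smul_right, real_inner_self_eq_norm_sq,
    real_inner_comm ξ ((ℝ ∙ y).starProjection ξ), norm_smul, mul_pow, Real.norm_eq_abs, sq_abs]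
  ring

theorem ellipticForm_one_le (y ξ : E) : ellipticForm φ 1 y ξ ≤ ‖ξ‖ ^ 2 :=
  (ellipticForm_one y ξ).trans_le (sub_le_self _ (by positivity))

namespace IncreasingDiffeo

variable (hφ : IncreasingDiffeo fun s => s * φ s)
include hφ

theorem le_ellipticForm_one {y : E} (hy : y ≠ 0) (ξ : E) :
    (1 - LamInftySq φ) * ‖ξ‖ ^ 2 ≤ ellipticForm φ 1 y ξ := by
  have hΛ := hφ.Lam_sq_le_LamInftySq (norm_pos_iff.2 hy)
  have hΛ_nonneg := (sq_nonneg _).trans hΛ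
  have hproj : ‖(ℝ ∙ y).starProjection ξ‖ ≤ ‖ξ‖ := Submodule.norm_starProjection_apply_le _ ξ
  rw [ellipticForm_one, sub_mul, one_mul]
  gcongr

theorem Lam_norm_smul_weight {y : E} (hy : y ≠ 0) :
    Lam φ ‖√(φ ‖y‖) • y‖ * (‖y‖ * deriv φ ‖y‖ + 2 * φ ‖y‖) = -(‖y‖ * deriv φ ‖y‖) := by
  have hy' := norm_pos_iff.2 hy
  rw [norm_smul, Real.norm_of_nonneg (Real.sqrt_nonneg _), mul_comm √_, hφ.Lam_mul_sqrt hy',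
    div_mul_cancel₀ _ (hφ.mul_deriv_add_two_mul_weight_pos hy').ne']

theorem radialMap_mul_radialJacobian_sqrt {y : E} (hy : y ≠ 0) :
    radialMap 1 (Lam φ ‖√(φ ‖y‖) • y‖) y * radialJacobian (fun s => √(φ s)) y =
      √(φ ‖y‖) • 1 := by
  have hy' := norm_pos_iff.2 hy
  have hpos := Real.sqrt_pos.2 (hφ.weight_pos hy')
  have hΛ := hφ.Lam_norm_smul_weight hy
  have hsq := Real.sq_sqrt (hφ.weight_pos hy').le
  rw [radialJacobian, (hφ.hasDerivAt_sqrt_weight hy').deriv, radialMap_mul, ← radialMap_zero _ y]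
  congr 1
  · rw [one_mul]
  · field_simp
    linear_combination hΛ + 2 * Lam φ ‖√(φ ‖y‖) • y‖ * hsq

theorem radialMap_neg_mul_radialJacobian_sqrt {y : E} (hy : y ≠ 0) :
    radialMap 1 (-Lam φ ‖√(φ ‖y‖) • y‖) y * radialJacobian (fun s => √(φ s)) y =
      (√(φ ‖y‖))⁻¹ • radialJacobian φ y := by
  have hy' := norm_pos_iff.2 hy
  have hpos := Real.sqrt_pos.2 (hφ.weight_pos hy')
  have hΛ := hφ.Lam_norm_smul_weight hy
  have hsq := Real.sq_sqrt (hφ.weight_pos hy').le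
  rw [radialJacobian, radialJacobian, (hφ.hasDerivAt_sqrt_weight hy').deriv, radialMap_mul,
    smul_radialMap]
  congr 1
  · field_simp
    exact hsq
  · field_simp
    linear_combination -hΛ - 2 * Lam φ ‖√(φ ‖y‖) • y‖ * hsq

/- With `v = √φ(|u|) u`, this turns the integrand of the dissipativity condition into the one of
the integral ellipticity condition. -/
theorem inner_radialJacobian_eq_ellipticForm (T : E →L[ℝ] E) {y : E} (hy : y ≠ 0) (η : E) :
    ⟪T η, radialJacobian φ y η⟫_ℝ =
      ellipticForm φ T (√(φ ‖y‖) • y) (radialJacobian (fun s => √(φ s)) y η) := by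
  have hpos := Real.sqrt_pos.2 (hφ.weight_pos (norm_pos_iff.2 hy))
  rw [ellipticForm, radialMap_smul _ _ hpos.ne', radialMap_smul _ _ hpos.ne',
    ← mul_apply_eq_comp (radialMap _ _ y), ← mul_apply_eq_comp (radialMap _ _ y),
    hφ.radialMap_mul_radialJacobian_sqrt hy, hφ.radialMap_neg_mul_radialJacobian_sqrt hy]
  simp [inner_smul_left, inner_smul_right, hpos.ne']

theorem exists_radialJacobian_sqrt_eq {y : E} (hy : y ≠ 0) (ξ : E) :
    ∃ η, radialJacobian (fun s => √(φ s)) y η = ξ := by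
  have hpos := Real.sqrt_pos.2 (hφ.weight_pos (norm_pos_iff.2 hy))
  refine ⟨(√(φ ‖y‖))⁻¹ • radialMap 1 (Lam φ ‖√(φ ‖y‖) • y‖) y ξ, ?_⟩
  have hcomm : radialJacobian (fun s => √(φ s)) y * radialMap 1 (Lam φ ‖√(φ ‖y‖) • y‖) y =
      √(φ ‖y‖) • 1 := by
    rw [← hφ.radialMap_mul_radialJacobian_sqrt hy, radialJacobian, radialMap_mul, radialMap_mul]
    congr 1 <;> ring
  rw [map_smul, ← mul_apply_eq_comp, hcomm]
  simp [smul_smul, hpos.ne']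

theorem exists_ne_zero_smul_sqrt_weight_eq {v : E} (hv : v ≠ 0) :
    ∃ y : E, y ≠ 0 ∧ √(φ ‖y‖) • y = v := by
  have hv' := norm_pos_iff.2 hv
  obtain ⟨s, hs : 0 < s, hsv⟩ := hφ.mul_sqrt_weight.exists_pos_eq hv'
  have hnorm : ‖(s * ‖v‖⁻¹) • v‖ = s := by
    rw [norm_smul, Real.norm_of_nonneg (by positivity), mul_assoc, inv_mul_cancel₀ hv'.ne', mul_one]
  refine ⟨(s * ‖v‖⁻¹) • v, smul_ne_zero (by positivity) hv, ?_⟩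
  rw [hnorm, smul_smul, ← mul_assoc, mul_comm √_, hsv, mul_inv_cancel₀ hv'.ne', one_smul]

end IncreasingDiffeo

end EllipticForm

section Localization

theorem exists_contDiff_eq_one_iff {Ω K : Set ℝ} (hΩ : IsOpen Ω) (hK : IsCompact K)
    (hKΩ : K ⊆ Ω) :
    ∃ χ : ℝ → ℝ, ContDiff ℝ 1 χ ∧ HasCompactSupport χ ∧ tsupport χ ⊆ Ω ∧
      (∀ x, χ x ∈ Icc 0 1) ∧ ∀ x, χ x = 1 ↔ x ∈ K := by
  obtain ⟨L, hL, hKL, hLΩ⟩ := exists_compact_between hK hΩ hKΩ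
  obtain ⟨χ, hχ, hrange, hsupp, hone⟩ := exists_contMDiff_support_eq_eq_one_iff (n := 1)
    (modelWithCornersSelf ℝ ℝ) isOpen_interior hK.isClosed hKL
  have hsub : tsupport χ ⊆ L := by
    rw [tsupport, hsupp]
    exact hL.isClosed.closure_interior_subset
  exact ⟨χ, hχ.contDiff, hL.of_isClosed_subset (isClosed_tsupport χ) hsub, hsub.trans hLΩ,
    fun x => hrange (mem_range_self x), fun x => (hone x).symm⟩

theorem exists_contDiff_eventually_eq_one {Ω K : Set ℝ} (hΩ : IsOpen Ω) (hK : IsCompact K)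
    (hKΩ : K ⊆ Ω) :
    ∃ χ : ℝ → ℝ, ContDiff ℝ 1 χ ∧ HasCompactSupport χ ∧ tsupport χ ⊆ Ω ∧
      ∀ x ∈ K, ∀ᶠ z in 𝓝 x, χ z = 1 := by
  obtain ⟨L, hL, hKL, hLΩ⟩ := exists_compact_between hK hΩ hKΩ
  obtain ⟨χ, hχ, hχc, hχΩ, -, hone⟩ := exists_contDiff_eq_one_iff hΩ hL hLΩ
  refine ⟨χ, hχ, hχc, hχΩ, fun x hx => ?_⟩
  filter_upwards [mem_interior_iff_mem_nhds.1 (hKL hx)] with z hz using (hone z).2 hz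

theorem setIntegral_nonneg_of_integral_sq_mul_nonneg {Ω K : Set ℝ} (hΩ : IsOpen Ω) {f : ℝ → ℝ}
    (hf : LocallyIntegrableOn f Ω)
    (h : ∀ ψ : ℝ → ℝ, ContDiff ℝ 1 ψ → HasCompactSupport ψ → tsupport ψ ⊆ Ω →
      0 ≤ ∫ x in Ω, ψ x ^ 2 * f x) (hK : IsCompact K) (hKΩ : K ⊆ Ω) :
    0 ≤ ∫ x in K, f x := by
  obtain ⟨χ, hχ, hχc, hχΩ, hχ_mem, hχ_one⟩ := exists_contDiff_eq_one_iff hΩ hK hKΩ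
  have hfL : IntegrableOn f (tsupport χ) := hf.integrableOn_compact_subset hχΩ hχc
  -- the powers of a cutoff that equals `1` exactly on `K` decrease to the indicator of `K`
  have hlim : Tendsto (fun n => ∫ x in tsupport χ, (χ x ^ (n + 1)) ^ 2 * f x) atTop
      (𝓝 (∫ x in tsupport χ, K.indicator f x)) := by
    refine tendsto_integral_of_dominated_convergence (fun x => ‖f x‖) (fun n => ?_) hfL.norm
      (fun n => ae_of_all _ fun x => ?_) (ae_of_all _ fun x => ?_)
    · exact ((hχ.continuous.pow _).pow 2).aestronglyMeasurable.mul hfL.aestronglyMeasurable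
    · rw [norm_mul, norm_pow, norm_pow, ← pow_mul, Real.norm_of_nonneg (hχ_mem x).1]
      exact mul_le_of_le_one_left (norm_nonneg _) (pow_le_one₀ (hχ_mem x).1 (hχ_mem x).2)
    · by_cases hx : x ∈ K
      · simp [indicator_of_mem hx, (hχ_one x).2 hx]
      · have hlt : χ x < 1 := lt_of_le_of_ne (hχ_mem x).2 fun h => hx ((hχ_one x).1 h)
        have hpow := (tendsto_add_atTop_iff_nat 1).2
          (tendsto_pow_atTop_nhds_zero_of_lt_one (hχ_mem x).1 hlt)
        simpa [indicator_of_notMem hx] using (hpow.pow 2).mul_const (f x)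
  have hKsupp : K ⊆ tsupport χ := fun x hx =>
    subset_tsupport χ (by simp [Function.mem_support, (hχ_one x).2 hx])
  rw [setIntegral_indicator hK.measurableSet, inter_eq_right.2 hKsupp] at hlim
  refine ge_of_tendsto' hlim fun n => ?_
  have hsub : tsupport (fun x => χ x ^ (n + 1)) ⊆ tsupport χ :=
    closure_mono fun x hx hx' => hx (by simp [hx'])
  rw [← setIntegral_eq_of_subset_of_forall_sdiff_eq_zero hΩ.measurableSet hχΩ fun x hx => by
    simp [image_eq_zero_of_notMem_tsupport hx.2]]
  exact h _ (hχ.pow _) (hχc.of_isClosed_subset (isClosed_tsupport _) hsub) (hsub.trans hχΩ)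

theorem ae_nonneg_of_forall_isCompact_setIntegral_nonneg {Ω : Set ℝ} (hΩ : IsOpen Ω) {f : ℝ → ℝ}
    (hf : LocallyIntegrableOn f Ω) (h : ∀ K, IsCompact K → K ⊆ Ω → 0 ≤ ∫ x in K, f x) :
    ∀ᵐ x ∂volume.restrict Ω, 0 ≤ f x := by
  obtain ⟨g, hg, hfg⟩ := hf.aestronglyMeasurable
  suffices hnull : volume ({x | g x < 0} ∩ Ω) = 0 by
    have hg_nonneg : ∀ᵐ x ∂volume.restrict Ω, 0 ≤ g x := by
      rw [ae_iff, Measure.restrict_apply' hΩ.measurableSet]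
      simpa only [not_le] using hnull
    filter_upwards [hg_nonneg, hfg] with x hx hx' using hx' ▸ hx
  by_contra hne
  obtain ⟨K, hK_sub, hK, hK_pos⟩ := ((measurableSet_lt hg.measurable measurable_const).inter
    hΩ.measurableSet).exists_lt_isCompact (pos_iff_ne_zero.2 hne)
  have hKΩ : K ⊆ Ω := hK_sub.trans inter_subset_right
  have hneg : ∀ᵐ x ∂volume.restrict K, 0 < -f x := by
    filter_upwards [ae_restrict_of_ae_restrict_of_subset hKΩ hfg,
      ae_restrict_mem hK.measurableSet] with x hx hxK
    exact neg_pos.2 (hx ▸ (hK_sub hxK).1)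
  have hint : IntegrableOn (fun x => -f x) K := (hf.integrableOn_compact_subset hKΩ hK).neg
  have hpos : 0 < ∫ x in K, -f x := by
    have hsupp : Function.support (fun x => -f x) =ᵐ[volume.restrict K] univ :=
      eventuallyEq_univ.2 (hneg.mono fun x hx => hx.ne')
    rwa [integral_pos_iff_support_of_nonneg_ae (hneg.mono fun x hx => hx.le) hint,
      measure_congr hsupp, Measure.restrict_apply_univ]
  rw [integral_neg] at hpos
  linarith [h K hK hKΩ]

theorem ae_forall_nonneg_of_isOpen {α X : Type*} [MeasurableSpace α] {μ : Measure α}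
    [TopologicalSpace X] [TopologicalSpace.SeparableSpace X] {U : Set X} (hU : IsOpen U)
    {f : α → X → ℝ} (hf : ∀ a, ContinuousOn (f a) U) (h : ∀ z ∈ U, ∀ᵐ a ∂μ, 0 ≤ f a z) :
    ∀ᵐ a ∂μ, ∀ z ∈ U, 0 ≤ f a z := by
  obtain ⟨s, hs_countable, hs_dense⟩ := TopologicalSpace.exists_countable_dense X
  filter_upwards [(ae_ball_iff (hs_countable.mono inter_subset_right)).2
    fun z (hz : z ∈ U ∩ s) => h z hz.1] with a ha z hz
  have hfreq : ∃ᶠ w in 𝓝 z, w ∈ U ∩ s :=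
    mem_closure_iff_frequently.1 (hs_dense.open_subset_closure_inter hU hz)
  exact ge_of_tendsto_of_frequently ((hf a).continuousAt (hU.mem_nhds hz))
    (hfreq.mono ha)

end Localization

section Oscillation

/-- The perturbation `N⁻¹ cos (N² x + θ) ψ(x)`: it is uniformly of size `N⁻¹`, while its derivative
is of size `N`. -/
def oscillation (ψ : ℝ → ℝ) (N θ x : ℝ) : ℝ := N⁻¹ * (Real.cos (N ^ 2 * x + θ) * ψ x)

/-- The derivative of `oscillation ψ N θ`, rescaled by `N⁻¹` so that it stays bounded as
`N → ∞`. -/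
def oscillationSlope (ψ : ℝ → ℝ) (N θ x : ℝ) : ℝ :=
  N⁻¹ ^ 2 * (Real.cos (N ^ 2 * x + θ) * deriv ψ x) - Real.sin (N ^ 2 * x + θ) * ψ x

variable {ψ : ℝ → ℝ}

theorem tsupport_oscillation_subset (ψ : ℝ → ℝ) (N θ : ℝ) :
    tsupport (oscillation ψ N θ) ⊆ tsupport ψ :=
  closure_mono fun x hx hx' => hx (by simp [oscillation, hx'])

theorem contDiff_oscillation (hψ : ContDiff ℝ 1 ψ) (N θ : ℝ) :
    ContDiff ℝ 1 (oscillation ψ N θ) := by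
  unfold oscillation
  fun_prop

theorem deriv_oscillation (hψ : ContDiff ℝ 1 ψ) {N : ℝ} (hN : N ≠ 0) (θ x : ℝ) :
    deriv (oscillation ψ N θ) x = N * oscillationSlope ψ N θ x := by
  have hphase : HasDerivAt (fun z => N ^ 2 * z + θ) (N ^ 2) x := by
    simpa using ((hasDerivAt_id' x).const_mul (N ^ 2)).add_const θ
  have hψx := (hψ.differentiable one_ne_zero x).hasDerivAt
  refine ((hphase.cos.mul hψx).const_mul N⁻¹).deriv.trans ?_
  rw [oscillationSlope]
  field_simp
  ring

theorem continuous_oscillationSlope (hψ : ContDiff ℝ 1 ψ) (N θ : ℝ) :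
    Continuous (oscillationSlope ψ N θ) := by
  have := hψ.continuous_deriv le_rfl
  unfold oscillationSlope
  fun_prop

theorem abs_oscillation_le (ψ : ℝ → ℝ) (N θ x : ℝ) : |oscillation ψ N θ x| ≤ |N⁻¹| * |ψ x| := by
  rw [oscillation, abs_mul, abs_mul]
  gcongr
  exact mul_le_of_le_one_left (abs_nonneg _) (Real.abs_cos_le_one _)

theorem abs_oscillationSlope_le (ψ : ℝ → ℝ) {N : ℝ} (hN : 1 ≤ N) (θ x : ℝ) :
    |oscillationSlope ψ N θ x| ≤ |deriv ψ x| + |ψ x| := by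
  have hN_inv : |N⁻¹ ^ 2| ≤ 1 := by
    rw [abs_of_nonneg (sq_nonneg _)]
    exact pow_le_one₀ (by positivity) (inv_le_one_of_one_le₀ hN)
  refine (abs_sub _ _).trans (add_le_add ?_ ?_) <;> simp only [abs_mul]
  · exact mul_le_of_le_one_left (by positivity) hN_inv |>.trans
      (mul_le_of_le_one_left (abs_nonneg _) (Real.abs_cos_le_one _))
  · exact mul_le_of_le_one_left (abs_nonneg _) (Real.abs_sin_le_one _)

theorem oscillationSlope_sq_add_sq (ψ : ℝ → ℝ) (N x : ℝ) :
    oscillationSlope ψ N 0 x ^ 2 + oscillationSlope ψ N (Real.pi / 2) x ^ 2 =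
      ψ x ^ 2 + N⁻¹ ^ 4 * deriv ψ x ^ 2 := by
  simp only [oscillationSlope, add_zero, Real.sin_add_pi_div_two, Real.cos_add_pi_div_two]
  linear_combination (ψ x ^ 2 + N⁻¹ ^ 4 * deriv ψ x ^ 2) * Real.sin_sq_add_cos_sq (N ^ 2 * x)

theorem tendsto_oscillation (ψ : ℝ → ℝ) (θ x : ℝ) :
    Tendsto (fun N => oscillation ψ N θ x) atTop (𝓝 0) :=
  squeeze_zero_norm (fun N => abs_oscillation_le ψ N θ x)
    (by simpa using tendsto_inv_atTop_zero.abs.mul_const |ψ x|)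

theorem tendsto_oscillationSlope_sq_mul_add (ψ : ℝ → ℝ) {f : ℝ → ℝ} (hf : ContinuousAt f 0)
    (x : ℝ) :
    Tendsto (fun N => oscillationSlope ψ N 0 x ^ 2 * f (oscillation ψ N 0 x) +
      oscillationSlope ψ N (Real.pi / 2) x ^ 2 * f (oscillation ψ N (Real.pi / 2) x)) atTop
      (𝓝 (ψ x ^ 2 * f 0)) := by
  have herror (θ : ℝ) : Tendsto (fun N => oscillationSlope ψ N θ x ^ 2 *
      (f (oscillation ψ N θ x) - f 0)) atTop (𝓝 0) := by
    have hlim := (hf.tendsto.comp (tendsto_oscillation ψ θ x)).sub_const (f 0)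
    rw [sub_self] at hlim
    refine squeeze_zero_norm' ?_
      (by simpa using hlim.norm.const_mul ((|deriv ψ x| + |ψ x|) ^ 2))
    filter_upwards [eventually_ge_atTop 1] with N hN
    rw [norm_mul, norm_pow]
    exact mul_le_mul_of_nonneg_right
      (pow_le_pow_left₀ (abs_nonneg _) (abs_oscillationSlope_le ψ hN θ x) 2) (norm_nonneg _)
  have hmain : Tendsto (fun N : ℝ => (ψ x ^ 2 + N⁻¹ ^ 4 * deriv ψ x ^ 2) * f 0) atTop
      (𝓝 (ψ x ^ 2 * f 0)) := by
    simpa using (((tendsto_inv_atTop_zero.pow 4).mul_const (deriv ψ x ^ 2)).const_add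
      (ψ x ^ 2)).mul_const (f 0)
  have hsum := ((herror 0).add (herror (Real.pi / 2))).add hmain
  simp only [zero_add, ← oscillationSlope_sq_add_sq] at hsum
  exact hsum.congr fun N => by ring

theorem exists_eventually_abs_oscillationSlope_sq_mul_le (hψ : ContDiff ℝ 1 ψ)
    (hψc : HasCompactSupport ψ) {f : ℝ → ℝ → ℝ} {g : ℝ → ℝ}
    (hfg : ∀ᶠ s in 𝓝 0, ∀ x, |f x s| ≤ g x) :
    ∃ C, ∀ᶠ N in atTop, ∀ θ x,
      |oscillationSlope ψ N θ x ^ 2 * f x (oscillation ψ N θ x)| ≤ C * g x := by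
  obtain ⟨M, hM⟩ := hψc.exists_bound_of_continuous hψ.continuous
  obtain ⟨M', hM'⟩ := hψc.deriv.exists_bound_of_continuous (hψ.continuous_deriv le_rfl)
  obtain ⟨δ, hδ, hδg⟩ := Metric.eventually_nhds_iff.1 hfg
  have hlim : Tendsto (fun N : ℝ => |N⁻¹| * M) atTop (𝓝 0) := by
    simpa using tendsto_inv_atTop_zero.abs.mul_const M
  refine ⟨(M' + M) ^ 2, ?_⟩
  filter_upwards [hlim.eventually_lt_const hδ, eventually_ge_atTop 1] with N hN hN_one θ x
  have hslope := (abs_oscillationSlope_le ψ hN_one θ x).trans (add_le_add (hM' x) (hM x))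
  have hsmall : |oscillation ψ N θ x| < δ := (abs_oscillation_le ψ N θ x).trans_lt
    ((mul_le_mul_of_nonneg_left (hM x) (abs_nonneg _)).trans_lt hN)
  rw [abs_mul, abs_pow]
  exact mul_le_mul (pow_le_pow_left₀ (abs_nonneg _) hslope 2)
    (hδg (by rwa [dist_zero_right, Real.norm_eq_abs]) x) (abs_nonneg _) (sq_nonneg _)

/- The phases `0` and `π / 2` are averaged so that `sin² + cos² = 1` replaces the weak limit of the
oscillating squares. -/
theorem integral_sq_mul_nonneg_of_oscillation (hψ : ContDiff ℝ 1 ψ) (hψc : HasCompactSupport ψ)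
    {μ : Measure ℝ} {f : ℝ → ℝ → ℝ} {g : ℝ → ℝ} (hg : Integrable g μ)
    (hfm : ∀ h : ℝ → ℝ, Continuous h → AEStronglyMeasurable (fun x => f x (h x)) μ)
    (hfg : ∀ᶠ s in 𝓝 0, ∀ x, |f x s| ≤ g x) (hf : ∀ x, ContinuousAt (f x) 0) (c : ℝ)
    (H : ∀ᶠ N in atTop, ∀ θ, 0 ≤ c + ∫ x, deriv (oscillation ψ N θ) x ^ 2 *
      f x (oscillation ψ N θ x) ∂μ) :
    0 ≤ ∫ x, ψ x ^ 2 * f x 0 ∂μ := by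
  let S : ℝ → ℝ → ℝ → ℝ := fun N θ x => oscillationSlope ψ N θ x ^ 2 * f x (oscillation ψ N θ x)
  obtain ⟨C, hC⟩ := exists_eventually_abs_oscillationSlope_sq_mul_le hψ hψc hfg
  have hSm (N θ : ℝ) : AEStronglyMeasurable (S N θ) μ :=
    ((continuous_oscillationSlope hψ N θ).pow 2).aestronglyMeasurable.mul
      (hfm _ (contDiff_oscillation hψ N θ).continuous)
  have hlim : Tendsto (fun N => ∫ x, (S N 0 x + S N (Real.pi / 2) x) ∂μ) atTop
      (𝓝 (∫ x, ψ x ^ 2 * f x 0 ∂μ)) := by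
    refine tendsto_integral_filter_of_dominated_convergence (fun x => C * g x + C * g x)
      (Eventually.of_forall fun N => (hSm N 0).add (hSm N (Real.pi / 2))) ?_
      ((hg.const_mul C).add (hg.const_mul C))
      (ae_of_all _ fun x => tendsto_oscillationSlope_sq_mul_add ψ (hf x) x)
    filter_upwards [hC] with N hN
    exact ae_of_all _ fun x => (norm_add_le _ _).trans (add_le_add (hN 0 x) (hN _ x))
  have hc : Tendsto (fun N : ℝ => 2 * (N⁻¹ ^ 2 * c)) atTop (𝓝 0) := by
    simpa using ((tendsto_inv_atTop_zero.pow 2).mul_const c).const_mul 2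
  rw [← zero_add (∫ x, ψ x ^ 2 * f x 0 ∂μ)]
  refine ge_of_tendsto (hc.add hlim) ?_
  filter_upwards [H, hC, eventually_gt_atTop 0] with N hN hNC hN_pos
  have hSint (θ : ℝ) : Integrable (S N θ) μ :=
    (hg.const_mul C).mono' (hSm N θ) (ae_of_all _ (hNC θ))
  have hlower (θ : ℝ) : 0 ≤ N⁻¹ ^ 2 * c + ∫ x, S N θ x ∂μ := by
    have h := mul_nonneg (sq_nonneg N⁻¹) (hN θ)
    simp only [deriv_oscillation hψ hN_pos.ne', mul_pow, mul_assoc, integral_const_mul] at h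
    rwa [mul_add, ← mul_assoc _ (N ^ 2), ← mul_pow, inv_mul_cancel₀ hN_pos.ne', one_pow,
      one_mul] at h
  rw [integral_add (hSint 0) (hSint _)]
  linarith [hlower 0, hlower (Real.pi / 2)]

end Oscillation

section Density

variable {E : Type*} [NormedAddCommGroup E] [InnerProductSpace ℝ E]

/-- The integrand `⟨B(x) P(u) u', Q(u) u'⟩`, which covers both the dissipativity condition
(`P = 1` and `Q` the differential of `y ↦ φ(|y|) y`) and the integral ellipticity condition
(`P = 1 + Λ Π` and `Q = 1 - Λ Π`). -/
def density (B : ℝ → E →L[ℝ] E) (P Q : E → E →L[ℝ] E) (u : ℝ → E) (x : ℝ) : ℝ :=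
  ⟪B x (P (u x) (deriv u x)), Q (u x) (deriv u x)⟫_ℝ

variable {B : ℝ → E →L[ℝ] E} {P Q : E → E →L[ℝ] E}

theorem density_congr {u v : ℝ → E} {x : ℝ} (h : u =ᶠ[𝓝 x] v) :
    density B P Q u x = density B P Q v x := by
  rw [density, density, h.eq_of_nhds, h.deriv_eq]

theorem density_const_add_smul {s : ℝ → ℝ} (hs : Differentiable ℝ s) (y ξ : E) (x : ℝ) :
    density B P Q (fun z => y + s z • ξ) x =
      deriv s x ^ 2 * ⟪B x (P (y + s x • ξ) ξ), Q (y + s x • ξ) ξ⟫_ℝ := by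
  have hderiv : deriv (fun z => y + s z • ξ) x = deriv s x • ξ :=
    (((hs x).hasDerivAt.smul_const ξ).const_add y).deriv
  simp only [density, hderiv, map_smul, real_inner_smul_left, real_inner_smul_right]
  ring

theorem integrable_inner_apply {α : Type*} [MeasurableSpace α] {μ : Measure α}
    {B : α → E →L[ℝ] E} (hB : Integrable B μ) {z w : α → E} (hz : AEStronglyMeasurable z μ)
    (hw : AEStronglyMeasurable w μ) {C D : ℝ} (hzC : ∀ᵐ a ∂μ, ‖z a‖ ≤ C)
    (hwD : ∀ᵐ a ∂μ, ‖w a‖ ≤ D) : Integrable (fun a => ⟪B a (z a), w a⟫_ℝ) μ := by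
  refine (hB.norm.mul_const (C * D)).mono'
    ((isBoundedBilinearMap_apply.continuous.comp_aestronglyMeasurable
      (hB.aestronglyMeasurable.prodMk hz)).inner hw) ?_
  filter_upwards [hzC, hwD] with a ha ha'
  calc ‖⟪B a (z a), w a⟫_ℝ‖ ≤ ‖B a‖ * ‖z a‖ * ‖w a‖ :=
        (norm_inner_le_norm _ _).trans
          (mul_le_mul_of_nonneg_right ((B a).le_opNorm _) (norm_nonneg _))
    _ ≤ ‖B a‖ * (C * D) := by
        rw [mul_assoc]
        have hC := (norm_nonneg _).trans ha
        gcongr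

theorem locallyIntegrableOn_inner_apply {Ω : Set ℝ} (hB : LocallyIntegrableOn B Ω) (z w : E) :
    LocallyIntegrableOn (fun x => ⟪B x z, w⟫_ℝ) Ω := by
  simp only [real_inner_comm w]
  exact ((innerSL ℝ w).comp (ContinuousLinearMap.apply ℝ E z)).locallyIntegrableOn_comp hB

theorem continuousAt_apply_add_smul (hP : ContinuousOn P {0}ᶜ) {y : E} (hy : y ≠ 0) (ξ : E) :
    ContinuousAt (fun s : ℝ => P (y + s • ξ) ξ) 0 := by
  have hPy : ContinuousAt P (y + (0 : ℝ) • ξ) := by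
    simpa using hP.continuousAt (isOpen_compl_singleton.mem_nhds hy)
  have hline : ContinuousAt (fun s : ℝ => y + s • ξ) 0 := by fun_prop
  exact (hPy.comp (f := fun s : ℝ => y + s • ξ) hline).clm_apply continuousAt_const

theorem setIntegral_density_add_smul {Ω K : Set ℝ} (hΩ : MeasurableSet Ω) (hK : MeasurableSet K)
    (hKΩ : K ⊆ Ω) {p : ℝ → E} {y : E} (hp : ∀ x ∈ K, p =ᶠ[𝓝 x] fun _ => y) {s : ℝ → ℝ}
    (hsK : tsupport s ⊆ K) (ξ : E)
    (hint : IntegrableOn (density B P Q (p + fun x => s x • ξ)) Ω) :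
    ∫ x in Ω, density B P Q (p + fun x => s x • ξ) x =
      (∫ x in Ω \ K, density B P Q p x) + ∫ x in K, density B P Q (fun x => y + s x • ξ) x := by
  have hoff : ∫ x in Ω \ K, density B P Q (p + fun x => s x • ξ) x =
      ∫ x in Ω \ K, density B P Q p x := by
    refine setIntegral_congr_fun (hΩ.diff hK) fun x hx => density_congr ?_
    filter_upwards [notMem_tsupport_iff_eventuallyEq.1 fun h => hx.2 (hsK h)] with z hz
    simp [hz]
  have hon : ∫ x in K, density B P Q (p + fun x => s x • ξ) x =
      ∫ x in K, density B P Q (fun x => y + s x • ξ) x := by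
    refine setIntegral_congr_fun hK fun x hx => density_congr ?_
    filter_upwards [hp x hx] with z hz
    simp [hz]
  rw [← hoff, ← hon, setIntegral_sdiff hK hint hKΩ, sub_add_cancel]

variable [FiniteDimensional ℝ E]

theorem stronglyMeasurable_comp_of_continuousOn_compl_zero (hP : ContinuousOn P {0}ᶜ)
    {u : ℝ → E} (hu : Continuous u) : StronglyMeasurable fun x => P (u x) := by
  borelize E
  exact (measurable_of_continuousOn_compl_singleton 0 hP).stronglyMeasurable.comp_measurable
    hu.measurable

theorem stronglyMeasurable_apply_of_continuousOn_compl_zero (hP : ContinuousOn P {0}ᶜ)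
    {u w : ℝ → E} (hu : Continuous u) (hw : Continuous w) :
    StronglyMeasurable fun x => P (u x) (w x) :=
  isBoundedBilinearMap_apply.continuous.comp_stronglyMeasurable
    ((stronglyMeasurable_comp_of_continuousOn_compl_zero hP hu).prodMk hw.stronglyMeasurable)

theorem integral_sq_mul_inner_nonneg_of_perturbation {K : Set ℝ} (hB : IntegrableOn B K)
    (hP : ContinuousOn P {0}ᶜ) (hQ : ContinuousOn Q {0}ᶜ) {y : E} (hy : y ≠ 0) (ξ : E)
    {ψ : ℝ → ℝ} (hψ : ContDiff ℝ 1 ψ) (hψc : HasCompactSupport ψ) (c : ℝ)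
    (H : ∀ s : ℝ → ℝ, ContDiff ℝ 1 s → tsupport s ⊆ tsupport ψ → (∀ x, ‖s x • ξ‖ < ‖y‖) →
      0 ≤ c + ∫ x in K, density B P Q (fun z => y + s z • ξ) x) :
    0 ≤ ∫ x in K, ψ x ^ 2 * ⟪B x (P y ξ), Q y ξ⟫_ℝ := by
  have hline (s : ℝ → ℝ) (hs : Continuous s) : Continuous fun x => y + s x • ξ := by fun_prop
  have hbdd {R : E → E →L[ℝ] E} (hR : ContinuousOn R {0}ᶜ) :
      ∃ C, ∀ᶠ s : ℝ in 𝓝 0, ‖R (y + s • ξ) ξ‖ ≤ C :=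
    ⟨_, (continuousAt_apply_add_smul hR hy ξ).norm.eventually_le_const (lt_add_one _)⟩
  obtain ⟨C, hC⟩ := hbdd hP
  obtain ⟨D, hD⟩ := hbdd hQ
  obtain ⟨M, hM⟩ := hψc.exists_bound_of_continuous hψ.continuous
  have hsmall : ∀ᶠ N : ℝ in atTop, |N⁻¹| * M * ‖ξ‖ < ‖y‖ := by
    have hlim : Tendsto (fun N : ℝ => |N⁻¹| * M * ‖ξ‖) atTop (𝓝 0) := by
      simpa using (tendsto_inv_atTop_zero.abs.mul_const M).mul_const ‖ξ‖
    exact hlim.eventually_lt_const (norm_pos_iff.2 hy)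
  have hmain := integral_sq_mul_nonneg_of_oscillation hψ hψc (μ := volume.restrict K)
    (f := fun x s => ⟪B x (P (y + s • ξ) ξ), Q (y + s • ξ) ξ⟫_ℝ) (hB.norm.mul_const (C * D))
    (fun h hh => ?_) ?_ (fun x => ?_) c ?_
  · simpa using hmain
  · exact (isBoundedBilinearMap_apply.continuous.comp_aestronglyMeasurable
      (hB.aestronglyMeasurable.prodMk (stronglyMeasurable_apply_of_continuousOn_compl_zero hP
        (hline h hh) continuous_const).aestronglyMeasurable)).inner
      (stronglyMeasurable_apply_of_continuousOn_compl_zero hQ (hline h hh)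
        continuous_const).aestronglyMeasurable
  · filter_upwards [hC, hD] with s hs hs' x
    refine (norm_inner_le_norm (𝕜 := ℝ) (B x _) _).trans ?_
    rw [← mul_assoc]
    exact mul_le_mul ((B x).le_opNorm_of_le hs) hs' (norm_nonneg _)
      (mul_nonneg (norm_nonneg _) ((norm_nonneg _).trans hs))
  · exact ((B x).continuous.continuousAt.comp (continuousAt_apply_add_smul hP hy ξ)).inner
      (continuousAt_apply_add_smul hQ hy ξ)
  · filter_upwards [hsmall] with N hN θ
    have hosc := contDiff_oscillation hψ N θ
    refine (H _ hosc (tsupport_oscillation_subset ψ N θ) fun x => ?_).trans_eq ?_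
    · rw [norm_smul]
      exact (mul_le_mul_of_nonneg_right ((abs_oscillation_le ψ N θ x).trans
        (mul_le_mul_of_nonneg_left (hM x) (abs_nonneg _))) (norm_nonneg _)).trans_lt hN
    · simp only [density_const_add_smul (hosc.differentiable one_ne_zero)]

theorem ae_forall_inner_nonneg_of_perturbation {Ω : Set ℝ} (hΩ : IsOpen Ω)
    (hB : LocallyIntegrableOn B Ω) (hP : ContinuousOn P {0}ᶜ) (hQ : ContinuousOn Q {0}ᶜ)
    (H : ∀ y ≠ 0, ∀ K, IsCompact K → K ⊆ Ω → ∃ p : ℝ → E, (∀ x ∈ K, p =ᶠ[𝓝 x] fun _ => y) ∧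
      ∀ h : ℝ → E, ContDiff ℝ 1 h → tsupport h ⊆ K → (∀ x, ‖h x‖ < ‖y‖) →
        IntegrableOn (density B P Q (p + h)) Ω ∧ 0 ≤ ∫ x in Ω, density B P Q (p + h) x) :
    ∀ᵐ x ∂volume.restrict Ω, ∀ y ≠ 0, ∀ ξ, 0 ≤ ⟪B x (P y ξ), Q y ξ⟫_ℝ := by
  have hfixed (y : E) (hy : y ≠ 0) (ξ : E) :
      ∀ᵐ x ∂volume.restrict Ω, 0 ≤ ⟪B x (P y ξ), Q y ξ⟫_ℝ := by
    have hloc := locallyIntegrableOn_inner_apply hB (P y ξ) (Q y ξ)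
    refine ae_nonneg_of_forall_isCompact_setIntegral_nonneg hΩ hloc fun L hL hLΩ =>
      setIntegral_nonneg_of_integral_sq_mul_nonneg hΩ hloc (fun ψ hψ hψc hψΩ => ?_) hL hLΩ
    obtain ⟨p, hp, hpos⟩ := H y hy _ hψc hψΩ
    rw [setIntegral_eq_of_subset_of_forall_sdiff_eq_zero hΩ.measurableSet hψΩ fun x hx => by
      simp [image_eq_zero_of_notMem_tsupport hx.2]]
    refine integral_sq_mul_inner_nonneg_of_perturbation
      (hB.integrableOn_compact_subset hψΩ hψc) hP hQ hy ξ hψ hψc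
      (∫ x in Ω \ tsupport ψ, density B P Q p x) fun s hs hsψ hsmall => ?_
    have hsupp : tsupport (fun x => s x • ξ) ⊆ tsupport ψ :=
      (closure_mono (Function.support_smul_subset_left s _)).trans hsψ
    obtain ⟨hint, hnonneg⟩ := hpos (fun x => s x • ξ) (hs.smul contDiff_const) hsupp hsmall
    rwa [setIntegral_density_add_smul hΩ.measurableSet (isClosed_tsupport ψ).measurableSet hψΩ hp
      hsψ ξ hint] at hnonneg
  have hU : IsOpen {q : E × E | q.1 ≠ 0} := isOpen_ne.preimage continuous_fst
  have happly {R : E → E →L[ℝ] E} (hR : ContinuousOn R {0}ᶜ) :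
      ContinuousOn (fun q : E × E => R q.1 q.2) {q | q.1 ≠ 0} :=
    (hR.comp continuousOn_fst fun _ hq => hq).clm_apply continuousOn_snd
  have hae := ae_forall_nonneg_of_isOpen (μ := volume.restrict Ω) hU
    (f := fun x q => ⟪B x (P q.1 q.2), Q q.1 q.2⟫_ℝ)
    (fun x => ((B x).continuous.comp_continuousOn (happly hP)).inner (happly hQ))
    fun q hq => hfixed q.1 hq q.2
  exact hae.mono fun x hx y hy ξ => hx (y, ξ) hy

end Density

section TestFunctions

variable {m : ℕ} {φ : ℝ → ℝ} {Ω K : Set ℝ}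

theorem TestFun.of_contDiff {u v : ℝ → EuclideanSpace ℂ (Fin m)} (hu : TestFun Ω u)
    (hv : ContDiff ℝ 1 v) (hzero : ∀ x, u x = 0 → v x = 0) : TestFun Ω v := by
  have hsub : tsupport v ⊆ tsupport u := closure_mono fun x hx hx' => hx (hzero x hx')
  exact ⟨hv, hu.2.1.of_isClosed_subset (isClosed_tsupport v) hsub, hsub.trans hu.2.2⟩

theorem weighted_eq_zero (φ : ℝ → ℝ) {u : ℝ → EuclideanSpace ℂ (Fin m)} {x : ℝ} (hx : u x = 0) :
    weighted φ u x = 0 := by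
  rw [weighted, hx, smul_zero]

theorem contDiffAt_weighted (hφ : ContDiffOn ℝ 1 φ (Ioi 0)) {u : ℝ → EuclideanSpace ℂ (Fin m)}
    {x : ℝ} (hu : ContDiffAt ℝ 1 u x) (hx : u x ≠ 0) : ContDiffAt ℝ 1 (weighted φ u) x :=
  ((hφ.contDiffAt (Ioi_mem_nhds (norm_pos_iff.2 hx))).comp x (hu.norm ℝ hx)).smul hu

theorem TestFun.add {p h : ℝ → EuclideanSpace ℂ (Fin m)} (hp : TestFun Ω p)
    (hh : TestFun Ω h) : TestFun Ω (p + h) :=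
  ⟨hp.1.add hh.1, hp.2.1.add hh.2.1, (tsupport_add p h).trans (union_subset hp.2.2 hh.2.2)⟩

theorem contDiff_weighted_add (hφ : ContDiffOn ℝ 1 φ (Ioi 0))
    {p h : ℝ → EuclideanSpace ℂ (Fin m)} (hp : ContDiff ℝ 1 p)
    (hp_weighted : ContDiff ℝ 1 (weighted φ p)) (hh : ContDiff ℝ 1 h)
    (hne : ∀ x ∈ tsupport h, p x + h x ≠ 0) : ContDiff ℝ 1 (weighted φ (p + h)) := by
  refine contDiff_iff_contDiffAt.2 fun x => ?_
  by_cases hx : x ∈ tsupport h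
  · exact contDiffAt_weighted hφ (hp.add hh).contDiffAt (hne x hx)
  · refine hp_weighted.contDiffAt.congr_of_eventuallyEq ?_
    filter_upwards [notMem_tsupport_iff_eventuallyEq.1 hx] with z hz
    simp [weighted, hz]

namespace IncreasingDiffeo

variable (hφ : IncreasingDiffeo fun s => s * φ s)
include hφ

theorem exists_testFun_eventually_eq (hΩ : IsOpen Ω) (hK : IsCompact K) (hKΩ : K ⊆ Ω)
    {y : EuclideanSpace ℂ (Fin m)} (hy : y ≠ 0) :
    ∃ p : ℝ → EuclideanSpace ℂ (Fin m), TestFun Ω p ∧ ContDiff ℝ 1 (weighted φ p) ∧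
      ∀ x ∈ K, p =ᶠ[𝓝 x] fun _ => y := by
  have hy' := norm_pos_iff.2 hy
  obtain ⟨χ, hχ, hχc, hχΩ, hχ_one⟩ := exists_contDiff_eventually_eq_one hΩ hK hKΩ
  obtain ⟨γ, hγ, hFγ, hγ_zero, hγ_one, hγ_nonneg⟩ := hφ.exists_contDiff_profile (zero_mul _) hy'
  let p : ℝ → EuclideanSpace ℂ (Fin m) := fun x => γ (χ x) • ‖y‖⁻¹ • y
  have hp_norm (x : ℝ) : ‖p x‖ = γ (χ x) := by
    rw [norm_smul, norm_smul, norm_inv, norm_norm, inv_mul_cancel₀ hy'.ne', mul_one,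
      Real.norm_of_nonneg (hγ_nonneg _)]
  have hp_weighted : weighted φ p = fun x => (γ (χ x) * φ (γ (χ x))) • ‖y‖⁻¹ • y := by
    funext x
    rw [weighted, hp_norm, smul_smul, mul_comm]
  have hsub : tsupport p ⊆ tsupport χ :=
    closure_mono fun x hx hx' => hx (by simp [p, hx', hγ_zero])
  refine ⟨p, ⟨(hγ.comp hχ).smul contDiff_const,
    hχc.of_isClosed_subset (isClosed_tsupport p) hsub, hsub.trans hχΩ⟩, ?_, fun x hx => ?_⟩
  · rw [hp_weighted]
    exact (hFγ.comp hχ).smul contDiff_const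
  · filter_upwards [hχ_one x hx] with z hz
    simp only [p, hz, hγ_one, smul_inv_smul₀ hy'.ne']

theorem exists_forall_testFun_add (hΩ : IsOpen Ω) (hK : IsCompact K) (hKΩ : K ⊆ Ω)
    {y : EuclideanSpace ℂ (Fin m)} (hy : y ≠ 0) :
    ∃ p : ℝ → EuclideanSpace ℂ (Fin m), (∀ x ∈ K, p =ᶠ[𝓝 x] fun _ => y) ∧
      ∀ h : ℝ → EuclideanSpace ℂ (Fin m), ContDiff ℝ 1 h → tsupport h ⊆ K →
        (∀ x, ‖h x‖ < ‖y‖) → TestFun Ω (p + h) ∧ TestFun Ω (weighted φ (p + h)) := by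
  obtain ⟨p, hp, hp_weighted, hpK⟩ := hφ.exists_testFun_eventually_eq hΩ hK hKΩ hy
  refine ⟨p, hpK, fun h hh hhK hhy => ?_⟩
  have hu : TestFun Ω (p + h) :=
    hp.add ⟨hh, hK.of_isClosed_subset (isClosed_tsupport h) hhK, hhK.trans hKΩ⟩
  refine ⟨hu, hu.of_contDiff (contDiff_weighted_add hφ.contDiffOn_weight hp.1 hp_weighted hh
    fun x hx h_zero => (hhy x).ne ?_) fun x => weighted_eq_zero φ⟩
  rw [(hpK x (hhK hx)).eq_of_nhds] at h_zero
  rw [eq_neg_of_add_eq_zero_left h_zero, norm_neg]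

end IncreasingDiffeo

end TestFunctions

section AlmostEverywhere

/- A zero of `u` that is not isolated is a critical point of `w`, and there are only countably many
isolated ones. -/
theorem ae_deriv_eq_zero_of_eq_zero {E F : Type*} [NormedAddCommGroup E] [NormedSpace ℝ E]
    [Zero F] {u : ℝ → F} {w : ℝ → E} (hw : ∀ y, u y = 0 → w y = 0) :
    ∀ᵐ x, u x = 0 → deriv w x = 0 := by
  have hcount := countable_setOfPred_isolated_right_within (s := {x | u x = 0})
  filter_upwards [hcount.ae_notMem volume] with x hx hux
  have hneBot : (𝓝[{y | u y = 0} ∩ Ioi x] x).NeBot := neBot_iff.2 fun h => hx ⟨hux, h⟩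
  refine deriv_zero_of_frequently_const (c := 0) (Frequently.filter_mono ?_
    (nhdsWithin_mono x (fun y hy => ne_of_gt hy.2 : {y | u y = 0} ∩ Ioi x ⊆ {x}ᶜ)))
  exact (eventually_mem_nhdsWithin.mono fun y hy => hw y hy.1).frequently

variable {m : ℕ} {φ : ℝ → ℝ} {u : ℝ → EuclideanSpace ℂ (Fin m)}

theorem ae_deriv_weighted (hφ : DifferentiableOn ℝ φ (Ioi 0)) (hu : Differentiable ℝ u) :
    ∀ᵐ x, deriv (weighted φ u) x = radialJacobian φ (u x) (deriv u x) := by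
  filter_upwards [ae_deriv_eq_zero_of_eq_zero (u := u) fun _ hy => hy,
    ae_deriv_eq_zero_of_eq_zero fun _ hy => weighted_eq_zero φ hy] with x hx hx_weighted
  by_cases hux : u x = 0
  · rw [hx hux, hx_weighted hux, map_zero]
  · exact (hasDerivAt_norm_smul (hu x).hasDerivAt hux
      (hφ.differentiableAt (Ioi_mem_nhds (norm_pos_iff.2 hux)))).deriv

theorem IncreasingDiffeo.ae_inner_deriv_weighted (hφ : IncreasingDiffeo fun s => s * φ s)
    (hu : Differentiable ℝ u) (T : ℝ → EuclideanSpace ℂ (Fin m) →L[ℝ] EuclideanSpace ℂ (Fin m)) :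
    ∀ᵐ x, ⟪T x (deriv u x), deriv (weighted φ u) x⟫_ℝ =
      ellipticForm φ (T x) (weighted (fun s => √(φ s)) u x)
        (deriv (weighted (fun s => √(φ s)) u) x) := by
  filter_upwards [ae_deriv_eq_zero_of_eq_zero (u := u) fun _ hy => hy,
    ae_deriv_weighted (hφ.contDiffOn_weight.differentiableOn one_ne_zero) hu,
    ae_deriv_weighted (φ := fun s => √(φ s)) (fun s hs =>
      (hφ.hasDerivAt_sqrt_weight hs).differentiableAt.differentiableWithinAt) hu]
    with x hx hx_weighted hx_sqrt
  rw [hx_weighted, hx_sqrt]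
  by_cases hux : u x = 0
  · simp only [hx hux, map_zero, inner_zero_left, ellipticForm_zero_right]
  · exact hφ.inner_radialJacobian_eq_ellipticForm (T x) hux (deriv u x)

end AlmostEverywhere

section Energy

variable {E : Type*} [NormedAddCommGroup E] [InnerProductSpace ℝ E] {φ : ℝ → ℝ} {Ω : Set ℝ}
  {T : ℝ → E →L[ℝ] E} {v : ℝ → E} {κ : ℝ}

/-- Strong `Φ`-ellipticity with constant `κ` for a real-linear coefficient `T`. The scalar `t > 0`
and the unit vector `ω` of the usual formulation are merged into the vector `y = t ω`. -/
def StrongEllipticWith (κ : ℝ) (φ : ℝ → ℝ) (Ω : Set ℝ) (T : ℝ → E →L[ℝ] E) : Prop :=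
  ∀ᵐ x ∂volume.restrict Ω, ∀ y ≠ 0, ∀ ξ, κ * ‖ξ‖ ^ 2 ≤ ellipticForm φ (T x) y ξ

theorem IncreasingDiffeo.strongEllipticWith_one (hφ : IncreasingDiffeo fun s => s * φ s)
    (Ω : Set ℝ) : StrongEllipticWith (1 - LamInftySq φ) φ Ω fun _ => (1 : E →L[ℝ] E) :=
  ae_of_all _ fun _ _ hy => hφ.le_ellipticForm_one hy

theorem StrongEllipticWith.of_sub_smul_one (hφ : IncreasingDiffeo fun s => s * φ s) (hκ : 0 ≤ κ)
    (hT : StrongEllipticWith 0 φ Ω fun x => T x - κ • 1) :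
    StrongEllipticWith (κ * (1 - LamInftySq φ)) φ Ω T := by
  filter_upwards [hT] with x hx y hy ξ
  have hsub := hx y hy ξ
  rw [ellipticForm_sub_smul_one, zero_mul, sub_nonneg] at hsub
  rw [mul_assoc]
  exact (mul_le_mul_of_nonneg_left (hφ.le_ellipticForm_one hy ξ) hκ).trans hsub

theorem StrongEllipticWith.ae_le_ellipticForm_deriv (hT : StrongEllipticWith κ φ Ω T)
    (v : ℝ → E) :
    ∀ᵐ x ∂volume.restrict Ω,
      κ * ‖deriv v x‖ ^ 2 ≤ ellipticForm φ (T x) (v x) (deriv v x) := by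
  filter_upwards [hT, ae_restrict_of_ae (ae_deriv_eq_zero_of_eq_zero (u := v) fun _ hy => hy)]
    with x hx hvx
  by_cases hv : v x = 0
  · simp [hvx hv, ellipticForm_zero_right]
  · exact hx _ hv _

theorem StrongEllipticWith.mul_integral_le (hT : StrongEllipticWith κ φ Ω T) (hκ : 0 ≤ κ)
    (hint : IntegrableOn (fun x => ellipticForm φ (T x) (v x) (deriv v x)) Ω) :
    κ * ∫ x in Ω, ‖deriv v x‖ ^ 2 ≤ ∫ x in Ω, ellipticForm φ (T x) (v x) (deriv v x) := by
  rw [← integral_const_mul]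
  exact integral_mono_of_nonneg (ae_of_all _ fun x => by positivity) hint
    (hT.ae_le_ellipticForm_deriv v)

theorem IncreasingDiffeo.integrableOn_norm_deriv_sq [CompleteSpace E]
    (hφ : IncreasingDiffeo fun s => s * φ s) (hΛ : LamInftySq φ < 1)
    (hint : IntegrableOn (fun x => ellipticForm φ 1 (v x) (deriv v x)) Ω) :
    IntegrableOn (fun x => ‖deriv v x‖ ^ 2) Ω := by
  refine (hint.const_mul (1 - LamInftySq φ)⁻¹).mono'
    ((stronglyMeasurable_deriv v).norm.pow 2).aestronglyMeasurable ?_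
  filter_upwards [(hφ.strongEllipticWith_one Ω).ae_le_ellipticForm_deriv v] with x hx
  rwa [Real.norm_of_nonneg (by positivity), ← div_eq_inv_mul, le_div_iff₀' (sub_pos.2 hΛ)]

theorem IncreasingDiffeo.integral_ellipticForm_sub_smul_one_nonneg [CompleteSpace E]
    (hφ : IncreasingDiffeo fun s => s * φ s) (hΛ : LamInftySq φ < 1) (hκ : 0 ≤ κ)
    (hint : IntegrableOn (fun x => ellipticForm φ (T x) (v x) (deriv v x)) Ω)
    (hint_one : IntegrableOn (fun x => ellipticForm φ 1 (v x) (deriv v x)) Ω)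
    (h : κ * ∫ x in Ω, ‖deriv v x‖ ^ 2 ≤ ∫ x in Ω, ellipticForm φ (T x) (v x) (deriv v x)) :
    0 ≤ ∫ x in Ω, ellipticForm φ (T x - κ • 1) (v x) (deriv v x) := by
  have hle : ∫ x in Ω, ellipticForm φ 1 (v x) (deriv v x) ≤ ∫ x in Ω, ‖deriv v x‖ ^ 2 :=
    integral_mono hint_one (hφ.integrableOn_norm_deriv_sq hΛ hint_one)
      fun x => ellipticForm_one_le (v x) (deriv v x)
  simp only [ellipticForm_sub_smul_one]
  rw [integral_sub hint (hint_one.const_mul κ), integral_const_mul, sub_nonneg]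
  exact (mul_le_mul_of_nonneg_left hle hκ).trans h

end Energy

section TestFunctionEnergy

variable {m : ℕ} {φ : ℝ → ℝ} {Ω : Set ℝ}
  {T : ℝ → EuclideanSpace ℂ (Fin m) →L[ℝ] EuclideanSpace ℂ (Fin m)}
  {u w : ℝ → EuclideanSpace ℂ (Fin m)}

theorem TestFun.exists_norm_deriv_le (hu : TestFun Ω u) : ∃ C, ∀ x, ‖deriv u x‖ ≤ C :=
  hu.2.1.deriv.exists_bound_of_continuous (hu.1.continuous_deriv le_rfl)

theorem TestFun.integrableOn_inner_apply (hu : TestFun Ω u) (hΩ : MeasurableSet Ω)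
    (hT : LocallyIntegrableOn T Ω) {z w : ℝ → EuclideanSpace ℂ (Fin m)}
    (hz : StronglyMeasurable z) (hw : StronglyMeasurable w) {C D : ℝ}
    (hzC : ∀ x, ‖z x‖ ≤ C * ‖deriv u x‖) (hwD : ∀ x, ‖w x‖ ≤ D) :
    IntegrableOn (fun x => ⟪T x (z x), w x⟫_ℝ) Ω := by
  have hTK : IntegrableOn T (tsupport u) := hT.integrableOn_compact_subset hu.2.2 hu.2.1
  obtain ⟨M, hM⟩ := hu.exists_norm_deriv_le
  have hzM : ∀ x, ‖z x‖ ≤ |C| * M := fun x => (hzC x).trans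
    (mul_le_mul (le_abs_self C) (hM x) (norm_nonneg _) (abs_nonneg C))
  refine IntegrableOn.of_forall_sdiff_eq_zero (integrable_inner_apply hTK hz.aestronglyMeasurable
    hw.aestronglyMeasurable (ae_of_all _ hzM) (ae_of_all _ hwD)) hΩ fun x hx => ?_
  have hderiv : deriv u x = 0 :=
    image_eq_zero_of_notMem_tsupport fun h => hx.2 (tsupport_deriv_subset h)
  have hzx : z x = 0 := norm_le_zero_iff.1 (by simpa [hderiv] using hzC x)
  rw [hzx, map_zero, inner_zero_left]

theorem TestFun.integrableOn_inner_deriv (hu : TestFun Ω u) (hw : TestFun Ω w)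
    (hΩ : MeasurableSet Ω) (hT : LocallyIntegrableOn T Ω) :
    IntegrableOn (fun x => ⟪T x (deriv u x), deriv w x⟫_ℝ) Ω := by
  obtain ⟨D, hD⟩ := hw.exists_norm_deriv_le
  exact hu.integrableOn_inner_apply hΩ hT (stronglyMeasurable_deriv u)
    (stronglyMeasurable_deriv w) (fun x => (one_mul _).ge) hD

theorem TestFun.integrableOn_ellipticForm (hu : TestFun Ω u)
    (hφ : IncreasingDiffeo fun s => s * φ s) (hΩ : MeasurableSet Ω)
    (hT : LocallyIntegrableOn T Ω) :
    IntegrableOn (fun x => ellipticForm φ (T x) (u x) (deriv u x)) Ω := by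
  obtain ⟨D, hD⟩ := hu.exists_norm_deriv_le
  have hderiv := hu.1.continuous_deriv le_rfl
  have hΛ : ∀ y : EuclideanSpace ℂ (Fin m), y ≠ 0 → |Lam φ ‖y‖| ≤ 1 := fun y hy =>
    (sq_le_one_iff_abs_le_one _).1 (hφ.Lam_sq_lt_one (norm_pos_iff.2 hy)).le
  refine hu.integrableOn_inner_apply (C := 2) (D := 2 * D) hΩ hT
    (stronglyMeasurable_apply_of_continuousOn_compl_zero
      (continuousOn_radialMap continuousOn_const hφ.continuousOn_Lam) hu.1.continuous hderiv)
    (stronglyMeasurable_apply_of_continuousOn_compl_zero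
      (continuousOn_radialMap continuousOn_const hφ.continuousOn_Lam.neg) hu.1.continuous hderiv)
    (fun x => norm_radialMap_one_apply_le (hΛ _) _)
    fun x => (norm_radialMap_one_apply_le (fun h => ?_) _).trans ?_
  · rw [abs_neg]
    exact hΛ _ h
  · linarith [hD x]

end TestFunctionEnergy

section Matrix

variable {m : ℕ} {φ : ℝ → ℝ} {Ω : Set ℝ} {A : ℝ → Matrix (Fin m) (Fin m) ℂ}

/-- The operator `z ↦ M z` as a real-linear map, depending linearly on `M`: all the forms of the
theorem are real parts, so only the real structure of `ℂ^m` matters. -/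
def actL : Matrix (Fin m) (Fin m) ℂ →ₗ[ℝ]
    EuclideanSpace ℂ (Fin m) →L[ℝ] EuclideanSpace ℂ (Fin m) :=
  ContinuousLinearMap.restrictScalarsₗ ℂ _ _ ℝ ℝ ∘ₗ
    ((Matrix.toEuclideanCLM (𝕜 := ℂ)).toAlgEquiv.toLinearMap).restrictScalars ℝ

theorem actL_apply (M : Matrix (Fin m) (Fin m) ℂ) (z : EuclideanSpace ℂ (Fin m)) :
    actL M z = act M z := rfl

theorem actL_one : actL (1 : Matrix (Fin m) (Fin m) ℂ) = 1 := by
  ext1 z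
  simp [actL_apply, act]

theorem reInner_eq_inner (z w : EuclideanSpace ℂ (Fin m)) : reInner z w = ⟪z, w⟫_ℝ := by
  simp [reInner, PiLp.inner_apply, mul_comm]

theorem reInner_act_conjTranspose (M : Matrix (Fin m) (Fin m) ℂ)
    (z w : EuclideanSpace ℂ (Fin m)) :
    reInner (act M.conjTranspose z) w = reInner z (act M w) := by
  have hadj : act M.conjTranspose z = (Matrix.toEuclideanCLM (𝕜 := ℂ) M).adjoint z :=
    DFunLike.congr_fun (map_star (Matrix.toEuclideanCLM (n := Fin m) (𝕜 := ℂ)) M) z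
  rw [reInner, hadj, ContinuousLinearMap.adjoint_inner_right]
  rfl

theorem locallyIntegrableOn_actL (hΩ : IsOpen Ω)
    (hA : ∀ i j, LocallyIntegrableOn (fun x => A x i j) Ω) :
    LocallyIntegrableOn (fun x => actL (A x)) Ω := by
  refine (locallyIntegrableOn_iff hΩ.isLocallyClosed).2 fun K hK hKc => ?_
  exact (actL ∘ₗ (Matrix.ofLinearEquiv ℝ).toLinearMap).toContinuousLinearMap.integrable_comp
    (φ := fun x i j => A x i j) (Integrable.of_eval fun i => Integrable.of_eval fun j =>
      (hA i j).integrableOn_compact_subset hK hKc)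

theorem reInner_act_sub_conjTranspose (M : Matrix (Fin m) (Fin m) ℂ)
    (z w : EuclideanSpace ℂ (Fin m)) :
    reInner (act (M - M.conjTranspose) z) w = reInner (act M z) w - reInner (act M w) z := by
  rw [reInner_eq_inner (act M w), real_inner_comm, ← reInner_eq_inner,
    ← reInner_act_conjTranspose]
  simp only [reInner_eq_inner, ← actL_apply, map_sub, sub_apply, inner_sub_left]

theorem inner_actL_radialMap (M : Matrix (Fin m) (Fin m) ℂ) (l : ℝ)
    (y ξ : EuclideanSpace ℂ (Fin m)) :
    ⟪actL M (radialMap 1 l y ξ), radialMap 1 (-l) y ξ⟫_ℝ =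
      reInner (act M ξ) ξ
        + l * (‖y‖ ^ 2)⁻¹ * reInner (act (M - M.conjTranspose) y) ξ * reInner y ξ
        - l ^ 2 * (‖y‖ ^ 4)⁻¹ * reInner (act M y) y * reInner y ξ ^ 2 := by
  rw [reInner_act_sub_conjTranspose]
  simp only [reInner_eq_inner, ← actL_apply, radialMap_apply, map_add, map_smul, inner_add_left,
    inner_add_right, real_inner_smul_left, real_inner_smul_right]
  ring

theorem ellipticForm_actL_smul (M : Matrix (Fin m) (Fin m) ℂ) {t : ℝ} (ht : 0 < t)
    {ω : EuclideanSpace ℂ (Fin m)} (hω : ‖ω‖ = 1) (ξ : EuclideanSpace ℂ (Fin m)) :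
    ellipticForm φ (actL M) (t • ω) ξ =
      reInner (act M ξ) ξ + Lam φ t * reInner (act (M - M.conjTranspose) ω) ξ * reInner ω ξ
        - Lam φ t ^ 2 * reInner (act M ω) ω * reInner ω ξ ^ 2 := by
  have hnorm : ‖t • ω‖ = t := by rw [norm_smul, hω, Real.norm_of_nonneg ht.le, mul_one]
  rw [ellipticForm, radialMap_smul _ _ ht.ne', radialMap_smul _ _ ht.ne', hnorm,
    inner_actL_radialMap, hω]
  simp only [one_pow, inv_one, mul_one]

theorem strongElliptic_iff :
    StrongElliptic φ Ω A ↔ ∃ κ, 0 < κ ∧ StrongEllipticWith κ φ Ω fun x => actL (A x) := by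
  refine exists_congr fun κ => and_congr_right fun _ => eventually_congr (ae_of_all _ fun x => ?_)
  constructor
  · intro h y hy ξ
    have hω : ‖‖y‖⁻¹ • y‖ = 1 := norm_smul_inv_norm (𝕜 := ℝ) hy
    have hy' := norm_pos_iff.2 hy
    rw [← smul_inv_smul₀ hy'.ne' y, ellipticForm_actL_smul _ hy' hω]
    exact h ‖y‖ hy' ξ _ hω
  · intro h t ht ξ ω hω
    rw [← ellipticForm_actL_smul _ ht hω]
    exact h _ (smul_ne_zero ht.ne' (norm_ne_zero_iff.1 (hω.trans_ne one_ne_zero))) ξ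

theorem weakElliptic_iff_strongElliptic : WeakElliptic φ Ω A ↔ StrongElliptic φ Ω A := by
  have hweak : ∀ (M : Matrix (Fin m) (Fin m) ℂ) (l q : ℝ) (ξ ω : EuclideanSpace ℂ (Fin m)),
      reInner (act ((q * q) • M) ξ) ξ
          - l ^ 2 * reInner (act ((q * q) • M) ω) ω * reInner ξ ω ^ 2
          + l * (reInner (act ((q * q) • M) ω) ξ - reInner (act ((q * q) • M) ξ) ω) *
            reInner ξ ω =
        q ^ 2 * (reInner (act M ξ) ξ
          + l * reInner (act (M - M.conjTranspose) ω) ξ * reInner ω ξ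
          - l ^ 2 * reInner (act M ω) ω * reInner ω ξ ^ 2) := by
    intro M l q ξ ω
    rw [reInner_act_sub_conjTranspose]
    simp only [reInner_eq_inner, ← actL_apply, map_smul, smul_apply, real_inner_smul_left,
      real_inner_comm ω ξ]
    ring
  simp only [WeakElliptic, StrongElliptic, hweak, sq_abs]
  refine exists_congr fun κ => and_congr_right fun _ => eventually_congr (ae_of_all _ fun x => ?_)
  refine forall₂_congr fun t _ => ⟨fun h ξ ω hω => ?_, fun h q ξ ω hω => ?_⟩
  · simpa using h 1 ξ ω hω
  · rw [mul_comm κ, mul_assoc]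
    exact mul_le_mul_of_nonneg_left (h ξ ω hω) (sq_nonneg q)

theorem ae_ellipticIntegrand_eq (v : ℝ → EuclideanSpace ℂ (Fin m)) :
    ∀ᵐ x, ellipticIntegrand φ A v x = ellipticForm φ (actL (A x)) (v x) (deriv v x) := by
  filter_upwards [ae_deriv_eq_zero_of_eq_zero (u := v) fun _ hy => hy] with x hx
  by_cases hv : v x = 0
  · rw [ellipticIntegrand, if_pos hv, hx hv, ellipticForm_zero_right]
  · rw [ellipticIntegrand, if_neg hv, ellipticForm, inner_actL_radialMap]

end Matrix

section Localized

variable {m : ℕ} {φ : ℝ → ℝ} {Ω : Set ℝ}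
  {T : ℝ → EuclideanSpace ℂ (Fin m) →L[ℝ] EuclideanSpace ℂ (Fin m)}
  (hφ : IncreasingDiffeo fun s => s * φ s)
include hφ

theorem IncreasingDiffeo.strongEllipticWith_zero_of_integral_ellipticForm_nonneg (hΩ : IsOpen Ω)
    (hT : LocallyIntegrableOn T Ω)
    (h : ∀ v, TestFun Ω v → 0 ≤ ∫ x in Ω, ellipticForm φ (T x) (v x) (deriv v x)) :
    StrongEllipticWith 0 φ Ω T := by
  have hpos := ae_forall_inner_nonneg_of_perturbation hΩ hT
    (continuousOn_radialMap (α := fun _ => 1) continuousOn_const hφ.continuousOn_Lam)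
    (continuousOn_radialMap (α := fun _ => 1) continuousOn_const hφ.continuousOn_Lam.neg)
    fun y hy K hK hKΩ => by
      obtain ⟨p, hpK, hp⟩ := hφ.exists_forall_testFun_add hΩ hK hKΩ hy
      refine ⟨p, hpK, fun q hq hqK hqy => ?_⟩
      have hv := (hp q hq hqK hqy).1
      exact ⟨hv.integrableOn_ellipticForm hφ hΩ.measurableSet hT, h _ hv⟩
  filter_upwards [hpos] with x hx v hv ξ
  rw [zero_mul]
  exact hx v hv ξ

theorem IncreasingDiffeo.strongEllipticWith_zero_of_integral_inner_nonneg (hΩ : IsOpen Ω)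
    (hT : LocallyIntegrableOn T Ω)
    (h : ∀ u, TestFun Ω u → TestFun Ω (weighted φ u) →
      0 ≤ ∫ x in Ω, ⟪T x (deriv u x), deriv (weighted φ u) x⟫_ℝ) :
    StrongEllipticWith 0 φ Ω T := by
  have hpos := ae_forall_inner_nonneg_of_perturbation (P := fun _ => 1) (Q := radialJacobian φ)
    hΩ hT continuousOn_const (continuousOn_radialJacobian hφ.contDiffOn_weight)
    fun y hy K hK hKΩ => by
      obtain ⟨p, hpK, hp⟩ := hφ.exists_forall_testFun_add hΩ hK hKΩ hy
      refine ⟨p, hpK, fun q hq hqK hqy => ?_⟩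
      obtain ⟨hu, hw⟩ := hp q hq hqK hqy
      have heq : (fun x => ⟪T x (deriv (p + q) x), deriv (weighted φ (p + q)) x⟫_ℝ)
          =ᵐ[volume.restrict Ω] density T (fun _ => 1) (radialJacobian φ) (p + q) := by
        filter_upwards [ae_restrict_of_ae (ae_deriv_weighted
          (hφ.contDiffOn_weight.differentiableOn one_ne_zero)
          (hu.1.differentiable one_ne_zero))] with x hx
        rw [hx, density, one_apply_eq_self]
      exact ⟨(hu.integrableOn_inner_deriv hw hΩ.measurableSet hT).congr heq,
        (h _ hu hw).trans_eq (integral_congr_ae heq)⟩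
  filter_upwards [hpos] with x hx v hv ξ
  obtain ⟨y, hy, rfl⟩ := hφ.exists_ne_zero_smul_sqrt_weight_eq hv
  obtain ⟨η, rfl⟩ := hφ.exists_radialJacobian_sqrt_eq hy ξ
  rw [zero_mul, ← hφ.inner_radialJacobian_eq_ellipticForm (T x) hy]
  exact hx y hy η

end Localized

section Equivalence

variable {m : ℕ} {φ : ℝ → ℝ} {Ω : Set ℝ} {A : ℝ → Matrix (Fin m) (Fin m) ℂ}
  {u v : ℝ → EuclideanSpace ℂ (Fin m)}

theorem isOpen_interval (a b : EReal) : IsOpen (interval a b) :=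
  (isOpen_lt continuous_const continuous_coe_real_ereal).inter
    (isOpen_lt continuous_coe_real_ereal continuous_const)

theorem integral_ellipticIntegrand_eq (v : ℝ → EuclideanSpace ℂ (Fin m)) :
    ∫ x in Ω, ellipticIntegrand φ A v x =
      ∫ x in Ω, ellipticForm φ (actL (A x)) (v x) (deriv v x) :=
  integral_congr_ae (ae_restrict_of_ae (ae_ellipticIntegrand_eq v))

namespace IncreasingDiffeo

variable (hφ : IncreasingDiffeo fun s => s * φ s)
include hφ

theorem integral_inner_deriv_weighted_eq (hu : TestFun Ω u)
    (T : ℝ → EuclideanSpace ℂ (Fin m) →L[ℝ] EuclideanSpace ℂ (Fin m)) :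
    ∫ x in Ω, ⟪T x (deriv u x), deriv (weighted φ u) x⟫_ℝ =
      ∫ x in Ω, ellipticForm φ (T x) (weighted (fun s => √(φ s)) u x)
        (deriv (weighted (fun s => √(φ s)) u) x) :=
  integral_congr_ae (ae_restrict_of_ae
    (hφ.ae_inner_deriv_weighted (hu.1.differentiable one_ne_zero) T))

theorem integrableOn_ellipticForm_weighted (hΩ : MeasurableSet Ω)
    {T : ℝ → EuclideanSpace ℂ (Fin m) →L[ℝ] EuclideanSpace ℂ (Fin m)}
    (hT : LocallyIntegrableOn T Ω) (hu : TestFun Ω u) (hw : TestFun Ω (weighted φ u)) :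
    IntegrableOn (fun x => ellipticForm φ (T x) (weighted (fun s => √(φ s)) u x)
      (deriv (weighted (fun s => √(φ s)) u) x)) Ω :=
  (hu.integrableOn_inner_deriv hw hΩ hT).congr (ae_restrict_of_ae
    (hφ.ae_inner_deriv_weighted (hu.1.differentiable one_ne_zero) T))

variable (hΩ : IsOpen Ω) (hT : LocallyIntegrableOn (fun x => actL (A x)) Ω)
include hΩ hT

theorem exists_dissipative_sub_of_strictDissipative (hΛ : LamInftySq φ < 1)
    (h : StrictDissipative φ Ω A) :
    ∃ κ : ℝ, 0 < κ ∧
      Dissipative φ Ω fun x => A x - κ • (1 : Matrix (Fin m) (Fin m) ℂ) := by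
  obtain ⟨κ, hκ, h⟩ := h
  refine ⟨κ, hκ, fun u hu hw => ?_⟩
  have hle := h u hu hw
  simp only [reInner_eq_inner, ← actL_apply, map_sub, map_smul, actL_one] at hle ⊢
  rw [hφ.integral_inner_deriv_weighted_eq hu fun x => actL (A x)] at hle
  rw [hφ.integral_inner_deriv_weighted_eq hu fun x => actL (A x) - κ • 1]
  exact hφ.integral_ellipticForm_sub_smul_one_nonneg hΛ hκ.le
    (hφ.integrableOn_ellipticForm_weighted hΩ.measurableSet hT hu hw)
    (hφ.integrableOn_ellipticForm_weighted hΩ.measurableSet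
      ((locallyIntegrable_const _).locallyIntegrableOn Ω) hu hw) hle

theorem strongElliptic_of_dissipative_sub (hΛ : LamInftySq φ < 1) {κ : ℝ} (hκ : 0 < κ)
    (h : Dissipative φ Ω fun x => A x - κ • (1 : Matrix (Fin m) (Fin m) ℂ)) :
    StrongElliptic φ Ω A := by
  refine strongElliptic_iff.2 ⟨κ * (1 - LamInftySq φ), mul_pos hκ (sub_pos.2 hΛ), ?_⟩
  refine .of_sub_smul_one hφ hκ.le (hφ.strongEllipticWith_zero_of_integral_inner_nonneg hΩ
    (hT.sub ((locallyIntegrable_const _).locallyIntegrableOn Ω)) fun u hu hw => ?_)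
  simpa only [reInner_eq_inner, ← actL_apply, map_sub, map_smul, actL_one] using h u hu hw

theorem strictDissipative_of_strongElliptic (h : StrongElliptic φ Ω A) :
    StrictDissipative φ Ω A := by
  obtain ⟨κ, hκ, h⟩ := strongElliptic_iff.1 h
  refine ⟨κ, hκ, fun u hu hw => ?_⟩
  simp only [reInner_eq_inner, ← actL_apply]
  rw [hφ.integral_inner_deriv_weighted_eq hu fun x => actL (A x)]
  exact h.mul_integral_le hκ.le
    (hφ.integrableOn_ellipticForm_weighted hΩ.measurableSet hT hu hw)

theorem integralElliptic_of_strongElliptic (h : StrongElliptic φ Ω A) :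
    IntegralElliptic φ Ω A := by
  obtain ⟨κ, hκ, h⟩ := strongElliptic_iff.1 h
  refine ⟨κ, hκ, fun v hv => ?_⟩
  rw [integral_ellipticIntegrand_eq]
  exact h.mul_integral_le hκ.le (hv.integrableOn_ellipticForm hφ hΩ.measurableSet hT)

theorem strongElliptic_of_integralElliptic (hΛ : LamInftySq φ < 1)
    (h : IntegralElliptic φ Ω A) : StrongElliptic φ Ω A := by
  obtain ⟨κ, hκ, h⟩ := h
  have hone : LocallyIntegrableOn
      (fun _ : ℝ => (1 : EuclideanSpace ℂ (Fin m) →L[ℝ] EuclideanSpace ℂ (Fin m))) Ω :=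
    (locallyIntegrable_const _).locallyIntegrableOn Ω
  refine strongElliptic_iff.2 ⟨κ * (1 - LamInftySq φ), mul_pos hκ (sub_pos.2 hΛ), ?_⟩
  refine .of_sub_smul_one hφ hκ.le
    (hφ.strongEllipticWith_zero_of_integral_ellipticForm_nonneg hΩ
      (hT.sub ((locallyIntegrable_const _).locallyIntegrableOn Ω)) fun v hv => ?_)
  refine hφ.integral_ellipticForm_sub_smul_one_nonneg hΛ hκ.le
    (hv.integrableOn_ellipticForm hφ hΩ.measurableSet hT)
    (hv.integrableOn_ellipticForm hφ hΩ.measurableSet hone) ?_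
  rw [← integral_ellipticIntegrand_eq]
  exact h v hv

end IncreasingDiffeo

end Equivalence

end

end FunctionalDissipativity

theorem mainTheorem8_general {φ : ℝ → ℝ}
    (hφ : FunctionalDissipativity.IncreasingDiffeo fun s => s * φ s)
    (hΛ : FunctionalDissipativity.LamInftySq φ < 1) {Ω : Set ℝ} (hΩ : IsOpen Ω) {m : ℕ}
    {A : ℝ → Matrix (Fin m) (Fin m) ℂ}
    (hA : ∀ i j, MeasureTheory.LocallyIntegrableOn (fun x => A x i j) Ω) :
    List.TFAE [
      FunctionalDissipativity.StrictDissipative φ Ω A,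
      ∃ κ : ℝ, 0 < κ ∧ FunctionalDissipativity.Dissipative φ Ω
        (fun x => A x - κ • (1 : Matrix (Fin m) (Fin m) ℂ)),
      FunctionalDissipativity.StrongElliptic φ Ω A,
      FunctionalDissipativity.IntegralElliptic φ Ω A,
      FunctionalDissipativity.WeakElliptic φ Ω A] := by
  have hT := FunctionalDissipativity.locallyIntegrableOn_actL hΩ hA
  tfae_have 1 → 2 := hφ.exists_dissipative_sub_of_strictDissipative hΩ hT hΛ
  tfae_have 2 → 3 := fun ⟨_, hκ, h⟩ => hφ.strongElliptic_of_dissipative_sub hΩ hT hΛ hκ h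
  tfae_have 3 → 1 := hφ.strictDissipative_of_strongElliptic hΩ hT
  tfae_have 3 → 4 := hφ.integralElliptic_of_strongElliptic hΩ hT
  tfae_have 4 → 3 := hφ.strongElliptic_of_integralElliptic hΩ hT hΛ
  tfae_have 5 ↔ 3 := FunctionalDissipativity.weakElliptic_iff_strongElliptic
  tfae_finish

theorem mainTheorem8 (φ : ℝ → ℝ) (hφ : FunctionalDissipativity.Admissible φ)
    (hΛ : FunctionalDissipativity.LamInftySq φ < 1)
    (m : ℕ) (a b : EReal) (hab : a < b)
    (A : ℝ → Matrix (Fin m) (Fin m) ℂ)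
    (hA : ∀ i j, MeasureTheory.LocallyIntegrableOn (fun x => A x i j)
      (FunctionalDissipativity.interval a b)) :
    List.TFAE [
      FunctionalDissipativity.StrictDissipative φ (FunctionalDissipativity.interval a b) A,
      ∃ κ : ℝ, 0 < κ ∧ FunctionalDissipativity.Dissipative φ
        (FunctionalDissipativity.interval a b)
        (fun x => A x - κ • (1 : Matrix (Fin m) (Fin m) ℂ)),
      FunctionalDissipativity.StrongElliptic φ (FunctionalDissipativity.interval a b) A,
      FunctionalDissipativity.IntegralElliptic φ (FunctionalDissipativity.interval a b) A,
      FunctionalDissipativity.WeakElliptic φ (FunctionalDissipativity.interval a b) A] :=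
  mainTheorem8_general hφ.increasingDiffeo hΛ (FunctionalDissipativity.isOpen_interval a b) hA
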